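/- Encode a shaded plane link diagram (faces 2-coloured) with $n$ crossings as a formal product of crossings $X_i[a,b,c,d]$, $i\in\{1,2\}$, where $a,b,c,d$ are the labels of the edges around the crossing in counterclockwise order and $a,c$ form the underpass; the crossing has type $X_1$ if the region swept in turning counterclockwise from the overpass to the underpass is shaded, and type $X_2$ otherwise. A crossingless circle is written $\mathrm{con}[a\,a]$. Expand each crossing by $$X_1[a,b,c,d]\to MA\,\mathrm{con}[ab]\mathrm{con}[cd]+MB\,\mathrm{con}[ad]\mathrm{con}[bc]+F\,\mathrm{con}[ac]\mathrm{con}[bd],$$ $$X_2[a,b,c,d]\to MX\,\mathrm{con}[ab]\mathrm{con}[cd]+MY\,\mathrm{con}[ad]\mathrm{con}[bc]+Z\,\mathrm{con}[ac]\mathrm{con}[bd],$$ and replace every resulting set of $m$ closed polygons by $o^m$. The result is the state sum $ss(D)\in\mathbb Z[A,B,F,X,Y,Z,M,o]$; it has $3^n$ states. Consider the four local moves $$X_1[a,b,f,e]X_2[d,e,f,c]=\mathrm{con}[ad]\mathrm{con}[bc],\qquad X_1[a,b,h,g]X_2[i,e,f,g]X_2[h,c,d,i]=X_1[a,i,h,f]X_1[c,g,i,b]X_2[h,g,d,e],$$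 and the two obtained from them by exchanging $X_1$ and $X_2$. Let $\mathcal I_\infty\subset\mathbb Q[A,B,F,X,Y,Z,M,o]$ be the ideal generated by the $2(3+15)=36$ differences $ss(\text{left}\cdot e)-ss(\text{right}\cdot e)$, where $e$ runs over the perfect matchings (3 or 15) of the boundary labels of the move, and let $\mathcal I_k=\mathcal I_\infty+(M^{k+1})$. Let $\eta_\infty(D)$ and $\eta_k(D)$ be the normal forms of $ss(D)$ modulo $\mathcal I_\infty$ and $\mathcal I_k$ for the lexicographical order with $A>B>F>X>Y>Z>M>o$, that is, the remainders on division by a Gröbner basis. The full VSE-invariant is $\eta_\infty$. Let $\langle D\rangle\in\mathbb Z[A^{\pm1}]$ be the Kauffman bracket of $D$, with $\langle \bigcirc\rangle=-A^2-A^{-2}$; this is the form of the Jones polynomial used here, as an invariant of regular isotopy. Let $U$ be the crossingless diagram of the 2-component unlink, let $JS_{14}$ be the product of the 20 crossings $X_1[13,20,14,1]$, $X_2[25,1,24,2]$, $X_1[38,2,37,3]$, $X_1[3,35,4,34]$, $X_2[4,22,5,21]$, $X_1[5,7,6,6]$, $X_1[7,9,8,8]$, $X_1[9,11,10,10]$,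 $X_1[11,18,12,19]$, $X_1[20,13,19,12]$, $X_1[24,14,23,15]$, $X_2[37,15,36,16]$, $X_2[16,36,17,35]$, $X_1[17,23,18,22]$, $X_2[40,34,21,33]$, $X_2[33,39,32,40]$, $X_2[38,32,39,31]$, $X_2[30,29,31,30]$, $X_2[28,27,29,28]$, $X_2[26,25,27,26]$, and let $T_{15}$ be Thistlethwaite's 15-crossing 2-component link with the Jones polynomial of the unlink, with three curls added that make the writhe of each component $0$: the product of $X_2[21,9,22,10]$, $X_1[35,10,34,11]$, $X_1[11,32,12,31]$, $X_2[12,24,13,25]$, $X_1[22,2,23,3]$, $X_2[34,3,33,4]$, $X_2[4,33,5,32]$, $X_1[5,23,6,24]$, $X_1[1,8,2,9]$, $X_1[13,15,14,14]$, $X_1[15,17,16,16]$, $X_1[17,19,18,18]$, $X_1[19,6,20,7]$, $X_1[8,1,7,20]$, $X_2[26,31,25,30]$, $X_2[30,27,29,26]$, $X_2[35,29,36,28]$, $X_2[28,36,27,21]$. Then: 1. $JS_{14}$ (with 20 crossings), $T_{15}$ and $U$ are shaded plane diagrams of links with two components, and $\langle JS_{14}\rangle=\langle U\rangle=\langle T_{15}\rangle$.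 2. $\eta_2(JS_{14})=o\bigl(16(Z^2-1)o^2+(16Z^2-15)o-32(Z^2-1)\bigr)$, which differs from $\eta_2(U)=\eta_2(T_{15})=o^2$. 3. Exactly $801$ of the $3^{20}$ states of $JS_{14}$ contribute a term that is nonzero modulo $M^3$. 4. The VSE-invariant is strictly stronger than the bracket: $\eta_\infty(D)=\eta_\infty(D')$ implies $\langle D\rangle=\langle D'\rangle$ for all $D,D'$, whereas $\eta_\infty(JS_{14})$ differs from $\eta_\infty(U)$ and from $\eta_\infty(T_{15})$ although the brackets agree. -/

import Mathlib

open MvPolynomial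

namespace VSE

/-! ### Formal link diagrams -/

/-- The two kinds of crossings of a diagram whose faces are 2-coloured. -/
inductive CrossingType where
  | X1
  | X2
  deriving DecidableEq

/-- A crossing `X1[a, b, c, d]` or `X2[a, b, c, d]`: the labels of the four edges around the
crossing in counterclockwise order, where `a` and `c` belong to the underpass and `b` and `d`
to the overpass. -/
structure Crossing where
  type : CrossingType
  a : ℕ
  b : ℕ
  c : ℕ
  d : ℕ
  deriving DecidableEq

/-- The crossing `X1[a, b, c, d]`. -/
def X1 (a b c d : ℕ) : Crossing := ⟨.X1, a, b, c, d⟩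

/-- The crossing `X2[a, b, c, d]`. -/
def X2 (a b c d : ℕ) : Crossing := ⟨.X2, a, b, c, d⟩

/-- A formal product of crossings and of arcs `con[a b]`. It encodes a tangle diagram; if every
label occurs exactly twice, there are no free ends. A crossingless circle is `con[a a]`. -/
structure Diagram where
  crossings : List Crossing
  arcs : List (ℕ × ℕ)

namespace Diagram

/-- The product of a diagram with further arcs. -/
def close (D : Diagram) (e : List (ℕ × ℕ)) : Diagram := ⟨D.crossings, D.arcs ++ e⟩

end Diagram

/-! ### The state sum -/

/-- The three ways to expand a crossing `X[a, b, c, d]`. -/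
inductive Smoothing where
  /-- `con[a b] con[c d]` -/
  | abcd
  /-- `con[a d] con[b c]` -/
  | adbc
  /-- the virtual term `con[a c] con[b d]` -/
  | virt
  deriving DecidableEq

instance : Fintype Smoothing := ⟨{.abcd, .adbc, .virt}, fun x => by cases x <;> decide⟩

/-- The two arcs by which a smoothing replaces a crossing. -/
def Crossing.arcs (x : Crossing) : Smoothing → List (ℕ × ℕ)
  | .abcd => [(x.a, x.b), (x.c, x.d)]
  | .adbc => [(x.a, x.d), (x.b, x.c)]
  | .virt => [(x.a, x.c), (x.b, x.d)]

/-- The number of polygons formed by a list of arcs in which every label occurs exactly twice.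
The bivalent vertices are eliminated one by one: `con[a b] con[b c]` becomes `con[a c]`, and
`con[a a]` is a closed polygon. -/
def loops : List (ℕ × ℕ) → ℕ
  | [] => 0
  | (a, b) :: l =>
    if a = b then loops l + 1
    else loops (l.map fun p => (if p.1 = b then a else p.1, if p.2 = b then a else p.2))
termination_by l => l.length

/-- The ring `ℤ[A, B, F, X, Y, Z, M, o]`; the variables are numbered in this order. -/
abbrev Ring8 := MvPolynomial (Fin 8) ℤ

noncomputable section

/-- The coefficients of the expansion of a crossing:
`X1[a,b,c,d] = M A con[a b] con[c d] + M B con[a d] con[b c] + F con[a c] con[b d]` and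
`X2[a,b,c,d] = M X con[a b] con[c d] + M Y con[a d] con[b c] + Z con[a c] con[b d]`. -/
def weight : CrossingType → Smoothing → Ring8
  | .X1, .abcd => X 6 * X 0
  | .X1, .adbc => X 6 * X 1
  | .X1, .virt => X 2
  | .X2, .abcd => X 6 * X 3
  | .X2, .adbc => X 6 * X 4
  | .X2, .virt => X 5

namespace Diagram

/-- A state chooses a smoothing at every crossing. -/
abbrev State (D : Diagram) := Fin D.crossings.length → Smoothing

/-- The arcs that remain after every crossing is expanded according to a state. -/
def stateArcs (D : Diagram) (s : D.State) : List (ℕ × ℕ) :=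
  D.arcs ++ (List.finRange D.crossings.length).flatMap fun i => (D.crossings.get i).arcs (s i)

/-- The contribution of a state: the product of its coefficients times `o ^ m`, where `m` is the
number of polygons. -/
def stateTerm (D : Diagram) (s : D.State) : Ring8 :=
  (∏ i, weight (D.crossings.get i).type (s i)) * X 7 ^ loops (D.stateArcs s)

/-- The VSE state sum, with `3 ^ n` states. -/
def stateSum (D : Diagram) : Ring8 := ∑ s : D.State, D.stateTerm s

/-- The states that do not vanish once `M ^ (k + 1) = 0`. -/
def nonNullStates (D : Diagram) (k : ℕ) : Set D.State :=
  {s | D.stateTerm s ∉ Ideal.span {(X 6 ^ (k + 1) : Ring8)}}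

/-- The Kauffman bracket as a state sum with `2 ^ n` states: at every crossing `A con[a b] con[c d]`
(here `true`) or `A⁻¹ con[a d] con[b c]` (here `false`), and each circle has the value
`-A ^ 2 - A ^ (-2)`. It is unnormalized: the bracket of a single circle is `-A ^ 2 - A ^ (-2)`. -/
def bracket (D : Diagram) : LaurentPolynomial ℤ :=
  ∑ σ : Fin D.crossings.length → Bool,
    (∏ i, LaurentPolynomial.T (if σ i then 1 else -1)) *
      (-LaurentPolynomial.T 2 - LaurentPolynomial.T (-2)) ^
        loops (D.stateArcs fun i => if σ i then .abcd else .adbc)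

end Diagram

/-! ### The ideals of the second and third Reidemeister moves -/

/-- A local move between two tangle diagrams with the same boundary labels. -/
structure Move where
  boundary : List ℕ
  left : Diagram
  right : Diagram

/-- Two moves of type 2 and two moves of type 3; the labels `a, b, …, i` are `1, 2, …, 9`. -/
def moves : List Move :=
  [ { boundary := [1, 2, 3, 4]
      left := ⟨[X1 1 2 6 5, X2 4 5 6 3], []⟩
      right := ⟨[], [(1, 4), (2, 3)]⟩ },
    { boundary := [1, 2, 3, 4]
      left := ⟨[X2 1 2 6 5, X1 4 5 6 3], []⟩
      right := ⟨[], [(1, 4), (2, 3)]⟩ },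
    { boundary := [1, 2, 3, 4, 5, 6]
      left := ⟨[X1 1 2 8 7, X2 9 5 6 7, X2 8 3 4 9], []⟩
      right := ⟨[X1 1 9 8 6, X1 3 7 9 2, X2 8 7 4 5], []⟩ },
    { boundary := [1, 2, 3, 4, 5, 6]
      left := ⟨[X2 1 2 8 7, X1 9 5 6 7, X1 8 3 4 9], []⟩
      right := ⟨[X2 1 9 8 6, X2 3 7 9 2, X1 8 7 4 5], []⟩ } ]

/-- The perfect matchings of a list of `2 * n` labels. -/
def pairings : ℕ → List ℕ → List (List (ℕ × ℕ))
  | 0, _ => [[]]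
  | _ + 1, [] => []
  | n + 1, a :: l => l.flatMap fun b => (pairings n (l.erase b)).map fun e => (a, b) :: e

/-- The exteriors of a move: the 3 (for type 2) or 15 (for type 3) ways in which the rest of a state
can connect the boundary labels. -/
def Move.exteriors (m : Move) : List (List (ℕ × ℕ)) :=
  pairings (m.boundary.length / 2) m.boundary

/-- The relations imposed by the moves of type 2 and 3: for every exterior, the difference of the
state sums of the two sides. -/
def relations : Set Ring8 :=
  {p | ∃ m ∈ moves, ∃ e ∈ m.exteriors,
    p = (m.left.close e).stateSum - (m.right.close e).stateSum}

/-- The inclusion of `ℤ[A, B, F, X, Y, Z, M, o]` into `ℚ[A, B, F, X, Y, Z, M, o]`, over which the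
Gröbner bases are taken. -/
def toRat : Ring8 →+* MvPolynomial (Fin 8) ℚ := MvPolynomial.map (Int.castRingHom ℚ)

/-- The ideal `𝓘_∞`. -/
def idealInf : Ideal (MvPolynomial (Fin 8) ℚ) := Ideal.span (toRat '' relations)

/-- The ideal `𝓘_k`, generated by `𝓘_∞` and `M ^ (k + 1)`. -/
def idealAt (k : ℕ) : Ideal (MvPolynomial (Fin 8) ℚ) :=
  idealInf ⊔ Ideal.span {(X 6 ^ (k + 1) : MvPolynomial (Fin 8) ℚ)}

/-! ### Normal forms -/

/-- `r` is the normal form of `p` modulo `I` for the lexicographical order with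
`A > B > F > X > Y > Z > M > o`: it is congruent to `p`, and none of its monomials is divisible by
the leading monomial of a nonzero element of `I`. This is the remainder of `p` on division by
any Gröbner basis of `I`. -/
def IsNormalForm (I : Ideal (MvPolynomial (Fin 8) ℚ)) (p r : MvPolynomial (Fin 8) ℚ) : Prop :=
  p - r ∈ I ∧ ∀ c ∈ r.support, ∀ f ∈ I, f ≠ 0 → ¬ MonomialOrder.lex.degree f ≤ c

theorem exists_isNormalForm (I : Ideal (MvPolynomial (Fin 8) ℚ)) (p : MvPolynomial (Fin 8) ℚ) :
    ∃ r, IsNormalForm I p r := by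
  have hB : ∀ b ∈ {f | f ∈ I ∧ f ≠ 0}, IsUnit (MonomialOrder.lex.leadingCoeff b) := by
    intro b hb
    exact isUnit_iff_ne_zero.mpr (MonomialOrder.leadingCoeff_ne_zero_iff.mpr hb.2)
  obtain ⟨g, r, h1, -, h3⟩ := MonomialOrder.div_set hB p
  refine ⟨r, ?_, fun c hc f hf hf0 => h3 c hc f ⟨hf, hf0⟩⟩
  rw [h1, add_sub_cancel_right, Finsupp.linearCombination_apply]
  exact Ideal.sum_mem _ fun b _ => I.mul_mem_left _ b.2.1

theorem isNormalForm_unique (I : Ideal (MvPolynomial (Fin 8) ℚ))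
    (p r r' : MvPolynomial (Fin 8) ℚ) (h : IsNormalForm I p r) (h' : IsNormalForm I p r') :
    r = r' := by
  by_contra hne
  have h0 : r - r' ≠ 0 := sub_ne_zero.mpr hne
  have hI : r - r' ∈ I := by
    have := I.sub_mem h'.1 h.1
    rwa [sub_sub_sub_cancel_left] at this
  have hd := MonomialOrder.degree_mem_support (m := MonomialOrder.lex) h0
  rcases Finset.mem_union.mp (MvPolynomial.support_sub _ r r' hd) with hr | hr
  · exact h.2 _ hr _ hI h0 le_rfl
  · exact h'.2 _ hr _ hI h0 le_rfl

/-- The normal form of a polynomial modulo an ideal. -/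
def normalForm (I : Ideal (MvPolynomial (Fin 8) ℚ)) (p : MvPolynomial (Fin 8) ℚ) :
    MvPolynomial (Fin 8) ℚ :=
  (exists_isNormalForm I p).choose

/-- The VSE-invariant `η_∞`. -/
def etaInf (D : Diagram) : MvPolynomial (Fin 8) ℚ := normalForm idealInf (toRat D.stateSum)

/-- The `k`-specialization `η_k` of the VSE-invariant. -/
def eta (k : ℕ) (D : Diagram) : MvPolynomial (Fin 8) ℚ :=
  normalForm (idealAt k) (toRat D.stateSum)

end

/-! ### Shaded link diagrams -/

namespace Diagram

/-- The edge ends at the crossings: the pair `(i, j)` is the `j`-th of the labels `a, b, c, d` of the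
crossing number `i`. The pair also names the corner between the ends `j` and `j + 1`. -/
abbrev End (D : Diagram) := Fin D.crossings.length × Fin 4

/-- The label of an edge end. -/
def label (D : Diagram) (p : D.End) : ℕ :=
  ![(D.crossings.get p.1).a, (D.crossings.get p.1).b, (D.crossings.get p.1).c,
    (D.crossings.get p.1).d] p.2

/-- Two edge ends are the two ends of one edge. -/
def Joined (D : Diagram) (p q : D.End) : Prop := p ≠ q ∧ D.label p = D.label q

/-- The corners `p` and `q` are consecutive corners of one face. -/
def FaceAdj (D : Diagram) (p q : D.End) : Prop := D.Joined (p.1, p.2 + 1) q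

/-- The crossings `i` and `j` lie on a common edge. -/
def CrossingAdj (D : Diagram) (i j : Fin D.crossings.length) : Prop :=
  ∃ s t, D.label (i, s) = D.label (j, t)

/-- Two edge ends lie on one strand: they belong to the same edge or face each other at
a crossing. -/
def StrandAdj (D : Diagram) (p q : D.End) : Prop := D.Joined p q ∨ q = (p.1, p.2 + 2)

/-- The region swept when one turns counterclockwise from the overpass to the underpass is
shaded at a crossing of type `X1` and white at a crossing of type `X2`. -/
def Shaded (D : Diagram) (p : D.End) : Prop :=
  (D.crossings.get p.1).type = .X1 ↔ (p.2 = 1 ∨ p.2 = 3)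

/-- A diagram of a link in the plane, with 2-coloured faces, plus some crossingless circles. -/
structure IsLinkDiagram (D : Diagram) : Prop where
  /-- every label occurs exactly twice -/
  closed : ∀ x ∈ (D.crossings.flatMap fun y => [y.a, y.b, y.c, y.d]) ++
      D.arcs.flatMap (fun p => [p.1, p.2]),
    ((D.crossings.flatMap fun y => [y.a, y.b, y.c, y.d]) ++
      D.arcs.flatMap (fun p => [p.1, p.2])).count x = 2
  circles : ∀ p ∈ D.arcs, p.1 = p.2
  /-- Euler's formula for a 4-valent plane graph: with `n` vertices, `2 * n` edges and `c`
  connected components, the cyclic orders at the vertices define `n + 2 * c` faces, where each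
  component is counted with its own outer face -/
  planar : Nat.card (Quot D.FaceAdj) = D.crossings.length + 2 * Nat.card (Quot D.CrossingAdj)
  /-- the corners of a face have the same colour -/
  shading : ∀ p q, D.FaceAdj p q → (D.Shaded p ↔ D.Shaded q)

/-- The number of components of a link diagram. -/
noncomputable def components (D : Diagram) : ℕ := Nat.card (Quot D.StrandAdj) + D.arcs.length

end Diagram

/-! ### The three links -/

/-- The crossingless diagram of the unlink with two components. -/
def unlink2 : Diagram := ⟨[], [(1, 1), (2, 2)]⟩

/-- The link `JS_14`, with curls added; 20 crossings. -/
def JS14 : Diagram where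
  crossings :=
    [ X1 13 20 14 1, X2 25 1 24 2, X1 38 2 37 3, X1 3 35 4 34, X2 4 22 5 21,
      X1 5 7 6 6, X1 7 9 8 8, X1 9 11 10 10, X1 11 18 12 19, X1 20 13 19 12,
      X1 24 14 23 15, X2 37 15 36 16, X2 16 36 17 35, X1 17 23 18 22, X2 40 34 21 33,
      X2 33 39 32 40, X2 38 32 39 31, X2 30 29 31 30, X2 28 27 29 28, X2 26 25 27 26 ]
  arcs := []

/-- Thistlethwaite's 15-crossing link of two components with the Jones polynomial of the unlink.
Eight crossings form the clasp of a doubled Hopf link, whose two bands are closed by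
a rational tangle of three crossings (lines 3 and 5) and by a rational tangle of four crossings
(the last line). The three curls in line 4 make the writhe of each component zero. -/
def T15 : Diagram where
  crossings :=
    [ X2 21 9 22 10, X1 35 10 34 11, X1 11 32 12 31, X2 12 24 13 25,
      X1 22 2 23 3, X2 34 3 33 4, X2 4 33 5 32, X1 5 23 6 24,
      X1 1 8 2 9,
      X1 13 15 14 14, X1 15 17 16 16, X1 17 19 18 18,
      X1 19 6 20 7, X1 8 1 7 20,
      X2 26 31 25 30, X2 30 27 29 26, X2 35 29 36 28, X2 28 36 27 21 ]
  arcs := []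

end VSE

/-!
A state sum is a sum over the smoothings of the crossings, weighted by monomials and by a power of
`o`. It can be computed crossing by crossing: only the way in which the arcs processed so far
connect the open ends matters, and the coefficients are sparse polynomials. Here `loops` is the
first Betti number of the graph formed by the arcs, so that it does not depend on the order of the
arcs (`loops_add_finrank`), and `contract_spec` says that the contraction computes the state sum.
All numerical facts are evaluations of such contractions.

The bracket is the value of the state sum at a point where the virtual terms vanish, and the local
moves hold at this point. Hence the bracket factors through `𝓘_∞`, and `η_∞` determines it
(`bracket_eq_of_etaInf_eq`).

The computation of `η_2` has two halves. First, no leading monomial of `𝓘_2` divides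
`Z ^ 2 * o ^ 3` (`not_degree_le`), so that the claimed values are in normal form. To see this, the
elements of `𝓘_2` are evaluated at points over `ℚ[t]` modulo `s ^ 3`, with `M = s`, at which the
local moves hold. There are such points for `o = 0`, `1`, `-2` and `2`, and suitable coefficients in
`s` and `t` give functionals that vanish on `𝓘_2` (`exists_functional`). An element of `𝓘_2` whose
leading monomial divides `Z ^ 2 * o ^ 3` would yield a nonzero polynomial in `o` of degree at most
`3` with these four roots.

Second, the state sums agree with the claimed values modulo `𝓘_2`. The state sum of a nonempty
diagram is divisible by `o`, so that one may compute modulo the ideal quotient `𝓘_2 : o`. Write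
`a, b, x, y` for `M A, M B, M X, M Y`. In the quotient, `F` is a polynomial in the other variables
(`ev_varF`), `Z ^ 2` can be eliminated (`ev_varZZ`), and the following elements vanish:
* `(o - 1) (x - y - a + b)`,
* `(o - 1) (o + 2) (y - b)`,
* `(o - 1) (o + 2) (a + b)`,
* `(o - 1) (a ^ 2 + o a b + b ^ 2)`,
* `(o - 1) (o ^ 2 - 4) b ^ 2`.

Once `F` and `Z ^ 2` are eliminated, the differences in question are combinations of these five
(`isReduction_JS14`, `isReduction_T15`).

Since equal values of `η_∞` imply equal values of `η_2`, the links are distinguished by `η_∞` as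
well. A state contributes modulo `M ^ 3` exactly if at most two smoothings are not virtual, which
leaves `1 + 2 * 20 + 4 * 190 = 801` states.
-/

namespace VSE

/-! ### Counting polygons -/

/-- The space spanned by the differences of the two ends of the arcs. Its dimension is the number
of labels minus the number of connected components of the graph formed by the arcs. -/
noncomputable def arcSpan (l : List (ℕ × ℕ)) : Submodule ℚ (ℕ →₀ ℚ) :=
  Submodule.span ℚ {x | ∃ p ∈ l, x = Finsupp.single p.1 1 - Finsupp.single p.2 1}

instance (l : List (ℕ × ℕ)) : FiniteDimensional ℚ (arcSpan l) := by
  refine FiniteDimensional.span_of_finite ℚ ?_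
  have : {x : ℕ →₀ ℚ | ∃ p ∈ l, x = Finsupp.single p.1 1 - Finsupp.single p.2 1} =
      (fun p : ℕ × ℕ => (Finsupp.single p.1 1 - Finsupp.single p.2 1 : ℕ →₀ ℚ)) '' {p | p ∈ l} := by
    ext x; simp [eq_comm]
  rw [this]
  exact (List.finite_toSet l).image _

theorem arcSpan_cons (a b : ℕ) (l : List (ℕ × ℕ)) :
    arcSpan ((a, b) :: l) =
      Submodule.span ℚ {(Finsupp.single a 1 - Finsupp.single b 1 : ℕ →₀ ℚ)} ⊔ arcSpan l := by
  rw [arcSpan, arcSpan, ← Submodule.span_union]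
  congr 1
  ext x
  simp

/-- Contracting the arc `(a, b)` lowers the dimension by one: the contraction maps one span onto the
other, and its kernel is the line spanned by the difference of the two ends. -/
theorem finrank_arcSpan_cons {a b : ℕ} (hab : a ≠ b) (l : List (ℕ × ℕ)) :
    Module.finrank ℚ (arcSpan ((a, b) :: l)) = Module.finrank ℚ (arcSpan (l.map fun p =>
      (if p.1 = b then a else p.1, if p.2 = b then a else p.2))) + 1 := by
  set c : ℕ → ℕ := fun x => if x = b then a else x with hc
  set φ : (ℕ →₀ ℚ) →ₗ[ℚ] (ℕ →₀ ℚ) := Finsupp.lmapDomain ℚ ℚ c with hφ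
  have hsingle : ∀ x : ℕ, φ (Finsupp.single x 1) = Finsupp.single (c x) 1 := fun x => by
    simp [hφ, Finsupp.lmapDomain_apply, Finsupp.mapDomain_single]
  set d : ℕ →₀ ℚ := Finsupp.single a 1 - Finsupp.single b 1 with hd
  have hd0 : d ≠ 0 := by
    intro h
    have := DFunLike.congr_fun h a
    simp [hd, hab.symm] at this
  have hφd : φ d = 0 := by
    simp [hd, map_sub, hsingle, hc]
  have hker : ∀ x : ℕ →₀ ℚ, x - φ x ∈ Submodule.span ℚ {d} := by
    intro x
    induction x using Finsupp.induction_linear with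
    | zero => simp
    | add f g hf hg =>
      have : f + g - φ (f + g) = (f - φ f) + (g - φ g) := by rw [map_add]; abel
      rw [this]
      exact Submodule.add_mem _ hf hg
    | single x r =>
      have h1 : Finsupp.single x r = r • (Finsupp.single x 1 : ℕ →₀ ℚ) := by simp
      rw [h1, map_smul, hsingle, ← smul_sub]
      refine Submodule.smul_mem _ _ ?_
      by_cases hx : x = b
      · have : (Finsupp.single x 1 - Finsupp.single (c x) 1 : ℕ →₀ ℚ) = -d := by
          simp [hc, hx, hd]
        rw [this]
        exact Submodule.neg_mem _ (Submodule.mem_span_singleton_self d)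
      · simp [hc, hx]
  have hmap : (arcSpan ((a, b) :: l)).map φ = arcSpan (l.map fun p => (c p.1, c p.2)) := by
    rw [arcSpan_cons, Submodule.map_sup, Submodule.map_span, Set.image_singleton]
    change Submodule.span ℚ {φ d} ⊔ _ = _
    rw [hφd, arcSpan, Submodule.map_span, arcSpan]
    simp only [Submodule.span_zero_singleton, bot_sup_eq]
    congr 1
    ext x
    simp only [Set.mem_image, Set.mem_ofPred_eq, List.mem_map]
    constructor
    · rintro ⟨_, ⟨p, hp, rfl⟩, rfl⟩
      exact ⟨_, ⟨p, hp, rfl⟩, by rw [map_sub, hsingle, hsingle]⟩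
    · rintro ⟨_, ⟨p, hp, rfl⟩, rfl⟩
      exact ⟨_, ⟨p, hp, rfl⟩, by rw [map_sub, hsingle, hsingle]⟩
  have hdmem : d ∈ arcSpan ((a, b) :: l) :=
    Submodule.subset_span ⟨(a, b), by simp, rfl⟩
  -- rank-nullity for the restriction of the contraction to the span
  have hrn := LinearMap.finrank_range_add_finrank_ker (φ.domRestrict (arcSpan ((a, b) :: l)))
  rw [LinearMap.range_domRestrict, hmap] at hrn
  have hk : Module.finrank ℚ (LinearMap.ker (φ.domRestrict (arcSpan ((a, b) :: l)))) = 1 := by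
    have hdker : (⟨d, hdmem⟩ : arcSpan ((a, b) :: l)) ∈
        LinearMap.ker (φ.domRestrict (arcSpan ((a, b) :: l))) := by simpa using hφd
    refine (finrank_eq_one_iff_of_nonzero' (⟨⟨d, hdmem⟩, hdker⟩ :
      LinearMap.ker (φ.domRestrict (arcSpan ((a, b) :: l)))) ?_).mpr ?_
    · intro h
      exact hd0 (congrArg Subtype.val (congrArg Subtype.val h))
    · rintro ⟨⟨x, hx⟩, hx0⟩
      have hx0' : φ x = 0 := by simpa using hx0
      have := hker x
      rw [hx0', sub_zero] at this
      obtain ⟨r, hr⟩ := Submodule.mem_span_singleton.mp this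
      exact ⟨r, by ext1; ext1; exact hr⟩
  rw [hk] at hrn
  exact hrn.symm

/-- The number of polygons is the first Betti number of the graph formed by the arcs. -/
theorem loops_add_finrank (l : List (ℕ × ℕ)) :
    loops l + Module.finrank ℚ (arcSpan l) = l.length := by
  induction hn : l.length using Nat.strong_induction_on generalizing l with
  | _ n ih =>
  subst hn
  match l with
  | [] =>
    have : arcSpan [] = ⊥ := by simp [arcSpan]
    rw [this]
    simp [loops]
  | (a, b) :: l =>
    rw [loops]
    split_ifs with hab
    · subst hab
      have := ih l.length (by simp) l rfl
      have h2 : arcSpan ((a, a) :: l) = arcSpan l := by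
        rw [arcSpan_cons, sub_self]; simp
      rw [h2, List.length_cons]
      omega
    · have := ih l.length (by simp) (l.map fun p =>
        (if p.1 = b then a else p.1, if p.2 = b then a else p.2)) (by simp)
      rw [finrank_arcSpan_cons hab, List.length_cons]
      omega

theorem loops_perm {l l' : List (ℕ × ℕ)} (h : l.Perm l') : loops l = loops l' := by
  have h1 := loops_add_finrank l
  have h2 := loops_add_finrank l'
  have h3 : arcSpan l = arcSpan l' := by
    unfold arcSpan
    congr 1
    ext x
    simp [h.mem_iff]
  rw [h3] at h1
  have := h.length_eq
  omega

theorem loops_swap (a b : ℕ) (l : List (ℕ × ℕ)) : loops ((a, b) :: l) = loops ((b, a) :: l) := by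
  have h1 := loops_add_finrank ((a, b) :: l)
  have h2 := loops_add_finrank ((b, a) :: l)
  have h3 : arcSpan ((a, b) :: l) = arcSpan ((b, a) :: l) := by
    rw [arcSpan_cons, arcSpan_cons, ← neg_sub, ← Set.neg_singleton, Submodule.span_neg]
  rw [h3] at h1
  simp only [List.length_cons] at h1 h2
  omega

theorem loops_cons_self (a : ℕ) (l : List (ℕ × ℕ)) : loops ((a, a) :: l) = loops l + 1 := by
  rw [loops, if_pos rfl]

/-- The labels of the ends of a list of arcs. -/
def arcEnds (l : List (ℕ × ℕ)) : List ℕ := l.flatMap fun p => [p.1, p.2]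

theorem arcEnds_cons (p : ℕ × ℕ) (l : List (ℕ × ℕ)) :
    arcEnds (p :: l) = p.1 :: p.2 :: arcEnds l := rfl

theorem arcEnds_append (l l' : List (ℕ × ℕ)) : arcEnds (l ++ l') = arcEnds l ++ arcEnds l' :=
  List.flatMap_append

/-- A bivalent vertex may be eliminated. -/
theorem loops_join {w u v : ℕ} {l : List (ℕ × ℕ)} (hwu : w ≠ u) (hvu : v ≠ u)
    (hu : u ∉ arcEnds l) : loops ((w, u) :: (u, v) :: l) = loops ((w, v) :: l) := by
  rw [loops, if_neg hwu, List.map_cons]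
  simp only [if_true, if_neg hvu]
  congr 2
  conv_rhs => rw [← List.map_id l]
  refine List.map_congr_left fun p hp => ?_
  have h : p.1 ≠ u ∧ p.2 ≠ u := by
    constructor <;> rintro rfl <;> exact hu (List.mem_flatMap.mpr ⟨p, hp, by simp⟩)
  simp [h.1, h.2]

end VSE

namespace VSE

/-! ### Sparse polynomials for computations in the kernel -/

/-- Monomials with a computable product and a computable comparison. Monomials that are not `kept`
are dropped in all computations; they stand for monomials with the value `0`. -/
class SparseMonomial (M : Type) where
  one : M
  mul : M → M → M
  cmp : M → M → Ordering
  kept : M → Bool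
  eq_of_cmp : ∀ {a b : M}, cmp a b = .eq → a = b

/-- A polynomial as a list of monomials with coefficients. The operations below keep the list
strictly increasing and free of zero coefficients, but nothing depends on this. -/
structure SparsePoly (M : Type) where
  terms : List (M × ℤ)

namespace SparsePoly

variable {M : Type} {R : Type*} [CommRing R] {χ : M → R}

/-- The value of a polynomial. -/
def ev (χ : M → R) (p : SparsePoly M) : R := (p.1.map fun t => (t.2 : R) * χ t.1).sum

theorem ev_mk_cons (a : M) (c : ℤ) (l : List (M × ℤ)) :
    ev χ ⟨(a, c) :: l⟩ = c * χ a + ev χ ⟨l⟩ := by simp [ev]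

theorem ev_mk_nil : ev χ ⟨[]⟩ = 0 := by simp [ev]

instance : Neg (SparsePoly M) := ⟨fun p => ⟨p.1.map fun t => (t.1, -t.2)⟩⟩

theorem ev_neg (p : SparsePoly M) : ev χ (-p) = -ev χ p := by
  change ev χ ⟨p.1.map _⟩ = _
  obtain ⟨l⟩ := p
  induction l with
  | nil => simp [ev]
  | cons t l ih =>
    simp only [List.map_cons] at ih ⊢
    rw [ev_mk_cons, ev_mk_cons, ih]; push_cast; ring

/-- The polynomial has no terms. -/
def isZero (p : SparsePoly M) : Bool := p.1.isEmpty

theorem ev_eq_zero {p : SparsePoly M} (h : p.isZero = true) : ev χ p = 0 := by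
  obtain ⟨l⟩ := p
  have : l = [] := by simpa [isZero] using h
  rw [this, ev_mk_nil]

variable [SparseMonomial M]

/-- The sum of two sorted lists of terms, with a bound on the number of steps. -/
def addTerms : ℕ → List (M × ℤ) → List (M × ℤ) → List (M × ℤ)
  | 0, p, q => p ++ q
  | _ + 1, [], q => q
  | _ + 1, t :: p, [] => t :: p
  | n + 1, (a, c) :: p, (b, d) :: q =>
    match SparseMonomial.cmp a b with
    | .lt => (a, c) :: addTerms n p ((b, d) :: q)
    | .gt => (b, d) :: addTerms n ((a, c) :: p) q
    | .eq =>
      match c + d with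
      | .ofNat 0 => addTerms n p q
      | s => (a, s) :: addTerms n p q

/-- The product of a term with a list of terms. -/
def mulTerm (a : M) (c : ℤ) : List (M × ℤ) → List (M × ℤ)
  | [] => []
  | (b, d) :: q =>
    match SparseMonomial.kept (SparseMonomial.mul a b) with
    | true => (SparseMonomial.mul a b, c * d) :: mulTerm a c q
    | false => mulTerm a c q

/-- The product of two lists of terms. -/
def mulTerms : List (M × ℤ) → List (M × ℤ) → List (M × ℤ)
  | [], _ => []
  | (a, c) :: p, q =>
    let s := mulTerm a c q
    let r := mulTerms p q
    addTerms (s.length + r.length) s r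

instance : Add (SparsePoly M) := ⟨fun p q => ⟨addTerms (p.1.length + q.1.length) p.1 q.1⟩⟩

instance : Mul (SparsePoly M) := ⟨fun p q => ⟨mulTerms p.1 q.1⟩⟩

instance : Sub (SparsePoly M) := ⟨fun p q => p + -q⟩

/-- The constant polynomial. -/
def const (c : ℤ) : SparsePoly M := ⟨if c = 0 then [] else [(SparseMonomial.one, c)]⟩

instance (n : ℕ) : OfNat (SparsePoly M) n := ⟨const n⟩

/-- Powers by repeated multiplication. -/
def npow (p : SparsePoly M) : ℕ → SparsePoly M
  | 0 => 1
  | n + 1 => npow p n * p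

instance : Pow (SparsePoly M) ℕ := ⟨npow⟩

/-- `χ` is multiplicative and vanishes on the monomials that are dropped. -/
structure IsChar (χ : M → R) : Prop where
  one : χ SparseMonomial.one = 1
  mul : ∀ a b, χ (SparseMonomial.mul a b) = χ a * χ b
  kept : ∀ a, SparseMonomial.kept a = false → χ a = 0

theorem ev_addTerms (n : ℕ) (p q : List (M × ℤ)) :
    ev χ ⟨addTerms n p q⟩ = ev χ ⟨p⟩ + ev χ ⟨q⟩ := by
  induction n generalizing p q with
  | zero => simp [addTerms, ev]
  | succ n ih =>
    match p, q with
    | [], q => simp [addTerms, ev_mk_nil]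
    | t :: p, [] => simp [addTerms, ev_mk_nil]
    | (a, c) :: p, (b, d) :: q =>
      rw [addTerms]
      split
      · rw [ev_mk_cons, ih, ev_mk_cons a c p]; ring
      · rw [ev_mk_cons, ih, ev_mk_cons b d q]; ring
      · rename_i h
        have hab := SparseMonomial.eq_of_cmp h
        subst hab
        split
        · rename_i h0
          have h1 : (c : R) + d = 0 := by simpa using congrArg (Int.cast : ℤ → R) h0
          rw [ih, ev_mk_cons, ev_mk_cons]
          linear_combination -χ a * h1
        · rw [ev_mk_cons, ih, ev_mk_cons, ev_mk_cons]; push_cast; ring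

theorem ev_add (p q : SparsePoly M) : ev χ (p + q) = ev χ p + ev χ q := ev_addTerms _ p.1 q.1

theorem ev_sub (p q : SparsePoly M) : ev χ (p - q) = ev χ p - ev χ q := by
  change ev χ (p + -q) = _
  rw [ev_add, ev_neg, sub_eq_add_neg]

theorem ev_eq {p q : SparsePoly M} (h : (p - q).isZero = true) : ev χ p = ev χ q := by
  rw [← sub_eq_zero, ← ev_sub, ev_eq_zero h]

theorem ev_mulTerm (hχ : IsChar χ) (a : M) (c : ℤ) (q : List (M × ℤ)) :
    ev χ ⟨mulTerm a c q⟩ = c * χ a * ev χ ⟨q⟩ := by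
  induction q with
  | nil => simp [mulTerm, ev_mk_nil]
  | cons t q ih =>
    obtain ⟨b, d⟩ := t
    rw [mulTerm]
    split
    · rw [ev_mk_cons, ev_mk_cons, ih, hχ.mul]; push_cast; ring
    · rename_i h
      have := hχ.mul a b
      rw [hχ.kept _ h] at this
      rw [ih, ev_mk_cons]
      linear_combination (c : R) * d * this

theorem ev_mul (hχ : IsChar χ) (p q : SparsePoly M) : ev χ (p * q) = ev χ p * ev χ q := by
  change ev χ ⟨mulTerms p.1 q.1⟩ = _
  obtain ⟨p⟩ := p
  induction p with
  | nil => simp [mulTerms, ev_mk_nil]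
  | cons t p ih =>
    obtain ⟨a, c⟩ := t
    simp only [mulTerms] at ih ⊢
    rw [ev_addTerms, ev_mulTerm hχ, ih, ev_mk_cons]; ring

theorem ev_const (hχ : IsChar χ) (c : ℤ) : ev χ (const c) = c := by
  rw [const]
  split_ifs with h
  · simp [ev, h]
  · simp [ev, hχ.one]

theorem ev_ofNat (hχ : IsChar χ) (n : ℕ) : ev χ (OfNat.ofNat n : SparsePoly M) = n := by
  change ev χ (const (n : ℤ)) = _
  rw [ev_const hχ]; simp

theorem ev_one (hχ : IsChar χ) : ev χ (1 : SparsePoly M) = 1 := by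
  simpa using ev_ofNat hχ 1

theorem ev_pow (hχ : IsChar χ) (p : SparsePoly M) (n : ℕ) : ev χ (p ^ n) = ev χ p ^ n := by
  induction n with
  | zero => exact (ev_one hχ).trans (pow_zero _).symm
  | succ n ih =>
    rw [pow_succ, ← ih]
    exact ev_mul hχ _ _

end SparsePoly

/-- The comparison of two exponents, refined by a comparison of the remaining ones. -/
def cmpNat (a b : ℕ) (next : Ordering) : Ordering :=
  match Nat.beq a b with
  | true => next
  | false => match Nat.ble a b with
    | true => .lt
    | false => .gt

theorem eq_of_cmpNat {a b : ℕ} {next : Ordering} (h : cmpNat a b next = .eq) :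
    a = b ∧ next = .eq := by
  unfold cmpNat at h
  split at h
  · exact ⟨Nat.eq_of_beq_eq_true ‹_›, h⟩
  · split at h <;> cases h

/-- The comparison of two integers by cases, which is fast in the kernel. -/
def cmpInt : ℤ → ℤ → Ordering
  | .ofNat a, .ofNat b => cmpNat a b .eq
  | .ofNat _, .negSucc _ => .gt
  | .negSucc _, .ofNat _ => .lt
  | .negSucc a, .negSucc b => cmpNat b a .eq

theorem eq_of_cmpInt {a b : ℤ} (h : cmpInt a b = .eq) : a = b := by
  cases a <;> cases b <;> simp only [cmpInt, reduceCtorEq] at h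
  · rw [(eq_of_cmpNat h).1]
  · rw [(eq_of_cmpNat h).1]

end VSE

namespace VSE

/-! ### State sums with arbitrary weights -/

section StateSum

variable {R : Type*} [CommRing R]

/-- The sum over the states of a list of crossings, completed by the arcs `l`, for arbitrary
coefficients `w` and an arbitrary value `o` of a polygon. -/
def weightedSum (w : CrossingType → Smoothing → R) (o : R) (cs : List Crossing)
    (l : List (ℕ × ℕ)) : R :=
  ∑ s : Fin cs.length → Smoothing, (∏ i, w (cs.get i).type (s i)) *
    o ^ loops (l ++ (List.finRange cs.length).flatMap fun i => (cs.get i).arcs (s i))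

theorem stateSum_eq_weightedSum (D : Diagram) :
    D.stateSum = weightedSum weight (X 7) D.crossings D.arcs := rfl

theorem map_weightedSum {S : Type*} [CommRing S] (φ : R →+* S)
    (w : CrossingType → Smoothing → R) (o : R) (cs : List Crossing) (l : List (ℕ × ℕ)) :
    φ (weightedSum w o cs l) = weightedSum (fun t s => φ (w t s)) (φ o) cs l := by
  simp [weightedSum, map_sum, map_prod]

variable {w : CrossingType → Smoothing → R} {o : R}

theorem weightedSum_nil (l : List (ℕ × ℕ)) : weightedSum w o [] l = o ^ loops l := by
  simp [weightedSum]

theorem weightedSum_cons (x : Crossing) (cs : List Crossing) (l : List (ℕ × ℕ)) :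
    weightedSum w o (x :: cs) l =
      ∑ s, w x.type s * weightedSum w o cs (l ++ x.arcs s) := by
  unfold weightedSum
  refine ((Fin.consEquiv fun _ : Fin (cs.length + 1) => Smoothing).sum_comp _).symm.trans ?_
  rw [Fintype.sum_prod_type]
  refine Finset.sum_congr rfl fun s _ => ?_
  rw [Finset.mul_sum]
  refine Finset.sum_congr rfl fun r _ => ?_
  have h1 : (∏ i : Fin (x :: cs).length, w ((x :: cs).get i).type
      ((Fin.consEquiv fun _ : Fin (cs.length + 1) => Smoothing) (s, r) i)) =
      w x.type s * ∏ i, w (cs.get i).type (r i) := Fin.prod_univ_succ _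
  have h2 : ((List.finRange (x :: cs).length).flatMap fun i => ((x :: cs).get i).arcs
      ((Fin.consEquiv fun _ : Fin (cs.length + 1) => Smoothing) (s, r) i)) =
      x.arcs s ++ (List.finRange cs.length).flatMap fun i => (cs.get i).arcs (r i) := by
    simp only [List.length_cons, List.finRange_succ, List.flatMap_cons, List.flatMap_map]
    rfl
  rw [h1, h2, mul_assoc, List.append_assoc]

theorem sum_smoothing {A : Type*} [AddCommMonoid A] (f : Smoothing → A) :
    ∑ s, f s = f .abcd + (f .adbc + f .virt) := by
  have : (Finset.univ : Finset Smoothing) = {.abcd, .adbc, .virt} := rfl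
  rw [this, Finset.sum_insert (by decide), Finset.sum_insert (by decide), Finset.sum_singleton]

theorem weightedSum_perm (cs : List Crossing) {l l' : List (ℕ × ℕ)} (h : l.Perm l') :
    weightedSum w o cs l = weightedSum w o cs l' := by
  unfold weightedSum
  refine Finset.sum_congr rfl fun s _ => ?_
  rw [loops_perm (h.append_right _)]

theorem weightedSum_swap (cs : List Crossing) (u v : ℕ) (l : List (ℕ × ℕ)) :
    weightedSum w o cs ((u, v) :: l) = weightedSum w o cs ((v, u) :: l) := by
  unfold weightedSum
  refine Finset.sum_congr rfl fun s _ => ?_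
  rw [List.cons_append, loops_swap, List.cons_append]

theorem weightedSum_loop (cs : List Crossing) (u : ℕ) (l : List (ℕ × ℕ)) :
    weightedSum w o cs ((u, u) :: l) = o * weightedSum w o cs l := by
  unfold weightedSum
  rw [Finset.mul_sum]
  refine Finset.sum_congr rfl fun s _ => ?_
  rw [List.cons_append, loops_cons_self]
  ring

/-- The labels at a list of crossings. -/
def crossingEnds (cs : List Crossing) : List ℕ := cs.flatMap fun y => [y.a, y.b, y.c, y.d]

theorem mem_crossing_of_mem_arcs {x : Crossing} {s : Smoothing} {u : ℕ}
    (h : u ∈ arcEnds (x.arcs s)) : u ∈ [x.a, x.b, x.c, x.d] := by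
  cases s <;> simp [Crossing.arcs, arcEnds] at h ⊢ <;> tauto

/-- Two arcs may be joined at a label that occurs nowhere else in the diagram. -/
theorem weightedSum_join (cs : List Crossing) {z u v : ℕ} {l : List (ℕ × ℕ)} (hz : z ≠ u)
    (hv : v ≠ u) (hl : u ∉ arcEnds l) (hc : u ∉ crossingEnds cs) :
    weightedSum w o cs ((z, u) :: (u, v) :: l) = weightedSum w o cs ((z, v) :: l) := by
  induction cs generalizing l with
  | nil => rw [weightedSum_nil, weightedSum_nil, loops_join hz hv hl]
  | cons x cs ih =>
    rw [crossingEnds, List.flatMap_cons, List.mem_append, not_or] at hc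
    rw [weightedSum_cons, weightedSum_cons]
    refine Finset.sum_congr rfl fun s _ => ?_
    congr 1
    refine ih ?_ hc.2
    change u ∉ arcEnds (l ++ x.arcs s)
    rw [arcEnds_append, List.mem_append, not_or]
    exact ⟨hl, fun h => hc.1 (mem_crossing_of_mem_arcs h)⟩

end StateSum

/-! ### Contraction of a diagram, crossing by crossing -/

/-- Every label occurs at most twice in a list of arcs and a list of crossings. This makes it safe
to eliminate a label as soon as it has been met twice. -/
def Fits (l : List (ℕ × ℕ)) (cs : List Crossing) : Prop :=
  ∀ x, (arcEnds l ++ crossingEnds cs).count x ≤ 2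

/-- Removes the first arc at `u` from a list of arcs, and returns its other end and the other
arcs. -/
def extract (u : ℕ) : List (ℕ × ℕ) → Option (ℕ × List (ℕ × ℕ))
  | [] => none
  | (a, b) :: l =>
    match Nat.beq a u with
    | true => some (b, l)
    | false => match Nat.beq b u with
      | true => some (a, l)
      | false => match extract u l with
        | some (z, l') => some (z, (a, b) :: l')
        | none => none

/-- Inserts an arc into a sorted list of arcs, so that matchings have a normal form. -/
def insertArc (u v : ℕ) : List (ℕ × ℕ) → List (ℕ × ℕ)
  | [] => [(u, v)]
  | (a, b) :: l =>
    match Nat.ble u a with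
    | true => (u, v) :: (a, b) :: l
    | false => (a, b) :: insertArc u v l

/-- Adds the arc `(u, v)` to a matching and eliminates bivalent vertices; the first component of the
result is the number of polygons that were closed. The first argument bounds the number of
steps. -/
def link : ℕ → ℕ → ℕ → List (ℕ × ℕ) → ℕ × List (ℕ × ℕ)
  | 0, u, v, l => (0, (u, v) :: l)
  | n + 1, u, v, l =>
    match Nat.beq u v with
    | true => (1, l)
    | false => match extract u l with
      | some (z, l') => link n z v l'
      | none => match extract v l with
        | some (z, l') => link n u z l'
        | none => match Nat.ble u v with
          | true => (0, insertArc u v l)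
          | false => (0, insertArc v u l)

theorem extract_spec {u z : ℕ} {l l' : List (ℕ × ℕ)} (h : extract u l = some (z, l')) :
    l.Perm ((z, u) :: l') ∨ l.Perm ((u, z) :: l') := by
  induction l generalizing l' with
  | nil => simp [extract] at h
  | cons p l ih =>
    obtain ⟨a, b⟩ := p
    rw [extract] at h
    split at h
    · rename_i ha
      have := Nat.eq_of_beq_eq_true ha
      simp only [Option.some.injEq, Prod.mk.injEq] at h
      obtain ⟨rfl, rfl⟩ := h
      subst this
      exact Or.inr (List.Perm.refl _)
    · split at h
      · rename_i hb
        have := Nat.eq_of_beq_eq_true hb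
        simp only [Option.some.injEq, Prod.mk.injEq] at h
        obtain ⟨rfl, rfl⟩ := h
        subst this
        exact Or.inl (List.Perm.refl _)
      · split at h
        · rename_i z' l'' he
          simp only [Option.some.injEq, Prod.mk.injEq] at h
          obtain ⟨rfl, rfl⟩ := h
          rcases ih he with h' | h'
          · exact Or.inl ((h'.cons _).trans (List.Perm.swap _ _ _))
          · exact Or.inr ((h'.cons _).trans (List.Perm.swap _ _ _))
        · cases h

theorem insertArc_perm (u v : ℕ) (l : List (ℕ × ℕ)) : (insertArc u v l).Perm ((u, v) :: l) := by
  induction l with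
  | nil => exact List.Perm.refl _
  | cons p l ih =>
    obtain ⟨a, b⟩ := p
    rw [insertArc]
    split
    · exact List.Perm.refl _
    · exact (ih.cons _).trans (List.Perm.swap _ _ _)

theorem arcEnds_perm {l l' : List (ℕ × ℕ)} (h : l.Perm l') : (arcEnds l).Perm (arcEnds l') :=
  h.flatMap_right _

theorem Fits.of_count {l l' : List (ℕ × ℕ)} {cs cs' : List Crossing} (h : Fits l cs)
    (hc : ∀ x, (arcEnds l').count x + (crossingEnds cs').count x ≤
      (arcEnds l).count x + (crossingEnds cs).count x) : Fits l' cs' := fun x => by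
  have := h x
  have := hc x
  rw [List.count_append] at *
  omega

theorem Fits.perm {l l' : List (ℕ × ℕ)} {cs : List Crossing} (h : Fits l cs) (hl : l.Perm l') :
    Fits l' cs :=
  h.of_count fun x => by rw [(arcEnds_perm hl).count_eq]

theorem Fits.swap {u v : ℕ} {l : List (ℕ × ℕ)} {cs : List Crossing} (h : Fits ((u, v) :: l) cs) :
    Fits ((v, u) :: l) cs :=
  h.of_count fun x => by simp only [arcEnds_cons, List.count_cons]; omega

variable {R : Type*} [CommRing R] {w : CrossingType → Smoothing → R} {o : R}

/-- Joining the arcs `(z, u)` and `(u, v)` at the label `u`, which then occurs nowhere else. -/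
theorem weightedSum_join_of_fits {z u v : ℕ} {l : List (ℕ × ℕ)} {cs : List Crossing}
    (h : Fits ((z, u) :: (u, v) :: l) cs) (huv : u ≠ v) :
    weightedSum w o cs ((z, u) :: (u, v) :: l) = weightedSum w o cs ((z, v) :: l) ∧
      Fits ((z, v) :: l) cs := by
  have hu := h u
  simp only [arcEnds_cons, List.count_append, List.count_cons, beq_self_eq_true, if_true] at hu
  have hz : z ≠ u := by
    rintro rfl
    rw [if_pos (beq_self_eq_true z)] at hu
    omega
  refine ⟨weightedSum_join cs hz huv.symm ?_ ?_, h.of_count fun x => ?_⟩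
  · rw [← List.count_eq_zero]; omega
  · rw [← List.count_eq_zero]; omega
  · simp only [arcEnds_cons, List.count_cons]; omega

/-- The matching computed by `link` may replace the given one in every sum over states, also in the
presence of the further arcs `as`. -/
theorem link_spec (n u v : ℕ) (l as : List (ℕ × ℕ)) (cs : List Crossing)
    (h : Fits ((u, v) :: (l ++ as)) cs) :
    weightedSum w o cs ((u, v) :: (l ++ as)) =
      o ^ (link n u v l).1 * weightedSum w o cs ((link n u v l).2 ++ as) ∧
      Fits ((link n u v l).2 ++ as) cs := by
  induction n generalizing u v l with
  | zero => simpa [link] using h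
  | succ n ih =>
    rw [link]
    split
    · rename_i huv
      have := Nat.eq_of_beq_eq_true huv
      subst this
      refine ⟨by rw [weightedSum_loop, pow_one], h.of_count fun x => ?_⟩
      simp only [arcEnds_cons, List.count_cons]; omega
    · rename_i huv
      have huv : u ≠ v := Nat.ne_of_beq_eq_false huv
      split
      · rename_i z l' he
        have key : weightedSum w o cs ((u, v) :: (l ++ as)) =
            weightedSum w o cs ((z, u) :: (u, v) :: (l' ++ as)) ∧
            Fits ((z, u) :: (u, v) :: (l' ++ as)) cs := by
          rcases extract_spec he with hp | hp
          · have hp' : ((u, v) :: (l ++ as)).Perm ((z, u) :: (u, v) :: (l' ++ as)) :=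
              ((hp.append_right as).cons _).trans (List.Perm.swap _ _ _)
            exact ⟨weightedSum_perm _ hp', h.perm hp'⟩
          · have hp' : ((u, v) :: (l ++ as)).Perm ((u, z) :: (u, v) :: (l' ++ as)) :=
              ((hp.append_right as).cons _).trans (List.Perm.swap _ _ _)
            exact ⟨(weightedSum_perm _ hp').trans (weightedSum_swap _ _ _ _), (h.perm hp').swap⟩
        have key2 := weightedSum_join_of_fits (w := w) (o := o) key.2 huv
        rw [key.1, key2.1]
        exact ih _ _ _ key2.2
      · split
        · rename_i z l' he
          have key : weightedSum w o cs ((u, v) :: (l ++ as)) =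
              weightedSum w o cs ((z, v) :: (v, u) :: (l' ++ as)) ∧
              Fits ((z, v) :: (v, u) :: (l' ++ as)) cs := by
            rw [weightedSum_swap]
            rcases extract_spec he with hp | hp
            · have hp' : ((v, u) :: (l ++ as)).Perm ((z, v) :: (v, u) :: (l' ++ as)) :=
                ((hp.append_right as).cons _).trans (List.Perm.swap _ _ _)
              exact ⟨weightedSum_perm _ hp', h.swap.perm hp'⟩
            · have hp' : ((v, u) :: (l ++ as)).Perm ((v, z) :: (v, u) :: (l' ++ as)) :=
                ((hp.append_right as).cons _).trans (List.Perm.swap _ _ _)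
              exact ⟨(weightedSum_perm _ hp').trans (weightedSum_swap _ _ _ _),
                (h.swap.perm hp').swap⟩
          have key2 := weightedSum_join_of_fits (w := w) (o := o) key.2 huv.symm
          rw [key.1, key2.1, weightedSum_swap]
          exact ih _ _ _ key2.2.swap
        · split
          · have hp : ((u, v) :: (l ++ as)).Perm (insertArc u v l ++ as) :=
              ((insertArc_perm u v l).append_right as).symm
            exact ⟨by rw [pow_zero, one_mul, weightedSum_perm _ hp], h.perm hp⟩
          · have hp : ((v, u) :: (l ++ as)).Perm (insertArc v u l ++ as) :=
              ((insertArc_perm v u l).append_right as).symm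
            exact ⟨by rw [pow_zero, one_mul, weightedSum_swap, weightedSum_perm _ hp],
              h.swap.perm hp⟩

end VSE

namespace VSE

/-- A sum of matchings with polynomial coefficients. -/
abbrev MatchingSum (M : Type) := List (List (ℕ × ℕ) × SparsePoly M)

variable {M : Type} {R : Type*} [CommRing R] {χ : M → R} {w : CrossingType → Smoothing → R} {o : R}

/-- The value of a sum of matchings, completed by the remaining crossings. -/
def matchingValue (χ : M → R) (w : CrossingType → Smoothing → R) (o : R) (cs : List Crossing)
    (st : MatchingSum M) : R :=
  (st.map fun t => t.2.ev χ * weightedSum w o cs t.1).sum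

theorem matchingValue_cons (cs : List Crossing) (t : List (ℕ × ℕ) × SparsePoly M)
    (st : MatchingSum M) : matchingValue χ w o cs (t :: st) =
      t.2.ev χ * weightedSum w o cs t.1 + matchingValue χ w o cs st := by
  simp [matchingValue]

variable [SparseMonomial M]

/-- Equality of lists of arcs by cases, which is fast in the kernel. -/
def sameArcs : List (ℕ × ℕ) → List (ℕ × ℕ) → Bool
  | [], [] => true
  | (a, b) :: l, (c, d) :: l' =>
    match Nat.beq a c with
    | true => match Nat.beq b d with
      | true => sameArcs l l'
      | false => false
    | false => false
  | _, _ => false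

theorem eq_of_sameArcs {l l' : List (ℕ × ℕ)} (h : sameArcs l l' = true) : l = l' := by
  induction l generalizing l' with
  | nil => cases l' <;> simp_all [sameArcs]
  | cons p l ih =>
    match l' with
    | [] => simp [sameArcs] at h
    | q :: l' =>
      rw [sameArcs] at h
      split at h
      · rename_i h1
        split at h
        · rename_i h2
          rw [ih h, Prod.ext (Nat.eq_of_beq_eq_true h1) (Nat.eq_of_beq_eq_true h2)]
        · cases h
      · cases h

/-- Adds a term to a sum of matchings. -/
def addMatching (l : List (ℕ × ℕ)) (p : SparsePoly M) : MatchingSum M → MatchingSum M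
  | [] => [(l, p)]
  | (l', p') :: st =>
    match sameArcs l l' with
    | true => (l', p + p') :: st
    | false => (l', p') :: addMatching l p st

/-- Adds an arc to a matching with a coefficient; the number of steps suffices for joining the arc
at both of its ends. -/
def linkArc (o : SparsePoly M) (a : ℕ × ℕ) (t : List (ℕ × ℕ) × SparsePoly M) :
    List (ℕ × ℕ) × SparsePoly M :=
  let r := link 4 a.1 a.2 t.1
  (r.2, match r.1 with
    | 0 => t.2
    | n + 1 => t.2 * o ^ (n + 1))

/-- Adds the term obtained by one smoothing of a crossing. -/
def smoothTerm (w : CrossingType → Smoothing → SparsePoly M) (o : SparsePoly M) (x : Crossing)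
    (s : Smoothing) (t : List (ℕ × ℕ) × SparsePoly M) (st : MatchingSum M) : MatchingSum M :=
  let r := (x.arcs s).foldl (fun t a => linkArc o a t) (t.1, w x.type s * t.2)
  match r.2.isZero with
  | true => st
  | false => addMatching r.1 r.2 st

/-- Expands a crossing in all matchings of a sum. -/
def expandCrossing (w : CrossingType → Smoothing → SparsePoly M) (o : SparsePoly M)
    (x : Crossing) : MatchingSum M → MatchingSum M
  | [] => []
  | t :: st => smoothTerm w o x .abcd t <| smoothTerm w o x .adbc t <|
      smoothTerm w o x .virt t <| expandCrossing w o x st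

/-- The state sum of a diagram, computed by expanding the crossings one after the other and
collecting the terms with the same matching. It fails if there are free ends. -/
def contract (w : CrossingType → Smoothing → SparsePoly M) (o : SparsePoly M) (D : Diagram) :
    Option (SparsePoly M) :=
  match D.crossings.foldl (fun st x => expandCrossing w o x st)
      [D.arcs.foldl (fun t a => linkArc o a t) ([], 1)] with
  | [] => some 0
  | [([], p)] => some p
  | _ => none

theorem addMatching_spec {cs : List Crossing} {l : List (ℕ × ℕ)} {p : SparsePoly M}
    {st : MatchingSum M} (hl : Fits l cs) (hst : ∀ t ∈ st, Fits t.1 cs) :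
    matchingValue χ w o cs (addMatching l p st) =
      p.ev χ * weightedSum w o cs l + matchingValue χ w o cs st ∧
      ∀ t ∈ addMatching l p st, Fits t.1 cs := by
  induction st with
  | nil => exact ⟨matchingValue_cons _ _ _, by simpa [addMatching] using hl⟩
  | cons t st ih =>
    obtain ⟨l', p'⟩ := t
    have h1 := hst _ List.mem_cons_self
    have ih := ih fun t ht => hst t (List.mem_cons_of_mem _ ht)
    rw [addMatching]
    split
    · rename_i h
      have := eq_of_sameArcs h
      subst this
      refine ⟨?_, ?_⟩
      · rw [matchingValue_cons, matchingValue_cons, SparsePoly.ev_add]; ring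
      · intro t ht
        rcases List.mem_cons.mp ht with rfl | ht
        · exact hl
        · exact hst t (List.mem_cons_of_mem _ ht)
    · refine ⟨?_, ?_⟩
      · rw [matchingValue_cons, matchingValue_cons, ih.1]; ring
      · intro t ht
        rcases List.mem_cons.mp ht with rfl | ht
        · exact h1
        · exact ih.2 t ht

variable {w' : CrossingType → Smoothing → SparsePoly M} {o' : SparsePoly M}

theorem linkArc_spec (hχ : SparsePoly.IsChar χ) (ho : o'.ev χ = o) {cs : List Crossing}
    {a : ℕ × ℕ} {as : List (ℕ × ℕ)} {t : List (ℕ × ℕ) × SparsePoly M}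
    (h : Fits (a :: (t.1 ++ as)) cs) :
    (linkArc o' a t).2.ev χ * weightedSum w o cs ((linkArc o' a t).1 ++ as) =
      t.2.ev χ * weightedSum w o cs (a :: (t.1 ++ as)) ∧ Fits ((linkArc o' a t).1 ++ as) cs := by
  have key := link_spec (w := w) (o := o) 4 a.1 a.2 t.1 as cs h
  refine ⟨?_, key.2⟩
  have h1 : a :: (t.1 ++ as) = (a.1, a.2) :: (t.1 ++ as) := rfl
  rw [h1, key.1]
  simp only [linkArc]
  cases (link 4 a.1 a.2 t.1).1 with
  | zero => simp
  | succ n =>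
    simp only
    rw [SparsePoly.ev_mul hχ, SparsePoly.ev_pow hχ, ho]; ring

theorem foldl_linkArc_spec (hχ : SparsePoly.IsChar χ) (ho : o'.ev χ = o) {cs : List Crossing}
    {as : List (ℕ × ℕ)} {t : List (ℕ × ℕ) × SparsePoly M} (h : Fits (t.1 ++ as) cs) :
    (as.foldl (fun t a => linkArc o' a t) t).2.ev χ *
        weightedSum w o cs (as.foldl (fun t a => linkArc o' a t) t).1 =
      t.2.ev χ * weightedSum w o cs (t.1 ++ as) ∧
      Fits (as.foldl (fun t a => linkArc o' a t) t).1 cs := by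
  induction as generalizing t with
  | nil => simpa using h
  | cons a as ih =>
    have h1 : (t.1 ++ a :: as).Perm (a :: (t.1 ++ as)) := List.perm_middle
    have key := linkArc_spec (w := w) hχ ho (h.perm h1)
    have := ih key.2
    rw [List.foldl_cons, weightedSum_perm cs h1, ← key.1]
    exact this

theorem Fits.smooth {l : List (ℕ × ℕ)} {x : Crossing} {cs : List Crossing}
    (h : Fits l (x :: cs)) (s : Smoothing) : Fits (l ++ x.arcs s) cs := by
  refine h.of_count fun y => ?_
  rw [arcEnds_append, List.count_append]
  cases s <;> simp only [Crossing.arcs, arcEnds, crossingEnds, List.count_append,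
    List.flatMap_cons, List.flatMap_nil, List.count_cons, List.count_nil] <;> omega

theorem smoothTerm_spec (hχ : SparsePoly.IsChar χ) (ho : o'.ev χ = o)
    (hw : ∀ t s, (w' t s).ev χ = w t s) {x : Crossing} {cs : List Crossing} (s : Smoothing)
    {t : List (ℕ × ℕ) × SparsePoly M} {st : MatchingSum M} (ht : Fits t.1 (x :: cs))
    (hst : ∀ t ∈ st, Fits t.1 cs) :
    matchingValue χ w o cs (smoothTerm w' o' x s t st) =
      t.2.ev χ * (w x.type s * weightedSum w o cs (t.1 ++ x.arcs s)) +
        matchingValue χ w o cs st ∧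
      ∀ r ∈ smoothTerm w' o' x s t st, Fits r.1 cs := by
  have key := foldl_linkArc_spec (w := w) hχ ho (t := (t.1, w' x.type s * t.2)) (ht.smooth s)
  simp only [SparsePoly.ev_mul hχ, hw] at key
  have key1 : t.2.ev χ * (w x.type s * weightedSum w o cs (t.1 ++ x.arcs s)) =
      w x.type s * t.2.ev χ * weightedSum w o cs (t.1 ++ x.arcs s) := by ring
  rw [key1, ← key.1]
  unfold smoothTerm
  generalize (x.arcs s).foldl (fun t a => linkArc o' a t) (t.1, w' x.type s * t.2) = r at key ⊢
  dsimp only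
  cases h : r.2.isZero with
  | true =>
    rw [SparsePoly.ev_eq_zero h, zero_mul, zero_add]
    exact ⟨rfl, hst⟩
  | false => exact addMatching_spec key.2 hst

theorem expandCrossing_spec (hχ : SparsePoly.IsChar χ) (ho : o'.ev χ = o)
    (hw : ∀ t s, (w' t s).ev χ = w t s) {x : Crossing} {cs : List Crossing} {st : MatchingSum M}
    (hst : ∀ t ∈ st, Fits t.1 (x :: cs)) :
    matchingValue χ w o cs (expandCrossing w' o' x st) = matchingValue χ w o (x :: cs) st ∧
      ∀ t ∈ expandCrossing w' o' x st, Fits t.1 cs := by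
  induction st with
  | nil => simp [expandCrossing, matchingValue]
  | cons t st ih =>
    have ht := hst _ List.mem_cons_self
    have h0 := ih fun t ht => hst t (List.mem_cons_of_mem _ ht)
    have h1 := smoothTerm_spec (w := w) hχ ho hw .virt ht h0.2
    have h2 := smoothTerm_spec (w := w) hχ ho hw .adbc ht h1.2
    have h3 := smoothTerm_spec (w := w) hχ ho hw .abcd ht h2.2
    refine ⟨?_, h3.2⟩
    rw [expandCrossing, h3.1, h2.1, h1.1, h0.1, matchingValue_cons, weightedSum_cons,
      sum_smoothing]
    ring

theorem foldl_expandCrossing_spec (hχ : SparsePoly.IsChar χ) (ho : o'.ev χ = o)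
    (hw : ∀ t s, (w' t s).ev χ = w t s) {cs : List Crossing} {st : MatchingSum M}
    (hst : ∀ t ∈ st, Fits t.1 cs) :
    matchingValue χ w o [] (cs.foldl (fun st x => expandCrossing w' o' x st) st) =
      matchingValue χ w o cs st := by
  induction cs generalizing st with
  | nil => rfl
  | cons x cs ih =>
    have h := expandCrossing_spec hχ ho hw hst
    rw [List.foldl_cons, ih h.2, h.1]

/-- The contraction of a diagram computes its state sum. -/
theorem contract_spec (hχ : SparsePoly.IsChar χ) (ho : o'.ev χ = o)
    (hw : ∀ t s, (w' t s).ev χ = w t s) {D : Diagram} {p : SparsePoly M}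
    (hD : Fits D.arcs D.crossings) (h : contract w' o' D = some p) :
    weightedSum w o D.crossings D.arcs = p.ev χ := by
  have h1 := foldl_linkArc_spec (w := w) hχ ho (t := (([] : List (ℕ × ℕ)), (1 : SparsePoly M)))
    (as := D.arcs) hD
  rw [List.nil_append, SparsePoly.ev_one hχ, one_mul] at h1
  have h2 := foldl_expandCrossing_spec hχ ho hw
    (st := [D.arcs.foldl (fun t a => linkArc o' a t) ([], 1)]) (cs := D.crossings)
    (by simpa using h1.2)
  have h3 : matchingValue χ w o D.crossings [D.arcs.foldl (fun t a => linkArc o' a t) ([], 1)] =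
      weightedSum w o D.crossings D.arcs := by
    rw [matchingValue_cons, h1.1]; simp [matchingValue]
  rw [← h3, ← h2]
  unfold contract at h
  split at h
  · rename_i he
    cases h
    rw [he, SparsePoly.ev_ofNat hχ]
    simp [matchingValue]
  · rename_i he
    cases h
    rw [he, matchingValue_cons, weightedSum_nil]
    simp [matchingValue, loops]
  · cases h

theorem fits_of_all {D : Diagram}
    (h : (arcEnds D.arcs ++ crossingEnds D.crossings).all
      (fun x => Nat.ble ((arcEnds D.arcs ++ crossingEnds D.crossings).count x) 2) = true) :
    Fits D.arcs D.crossings := fun x => by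
  by_cases hx : x ∈ arcEnds D.arcs ++ crossingEnds D.crossings
  · exact Nat.le_of_ble_eq_true (List.all_eq_true.mp h x hx)
  · rw [List.count_eq_zero.mpr hx]; omega

end VSE

namespace VSE

/-! ### The Kauffman bracket -/

/-- The powers of the variable of a Laurent polynomial. -/
instance : SparseMonomial ℤ where
  one := 0
  mul a b := a + b
  cmp := cmpInt
  kept _ := true
  eq_of_cmp := eq_of_cmpInt

/-- The coefficients of the Kauffman bracket as a state sum with `3 ^ n` states, in which the
virtual smoothing has the coefficient `0`. -/
noncomputable def bracketWeight (R : Type*) [CommRing R] :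
    CrossingType → Smoothing → LaurentPolynomial R
  | _, .abcd => LaurentPolynomial.T 1
  | _, .adbc => LaurentPolynomial.T (-1)
  | _, .virt => 0

/-- The value of a polygon in the Kauffman bracket. -/
noncomputable def bracketLoop (R : Type*) [CommRing R] : LaurentPolynomial R :=
  -LaurentPolynomial.T 2 - LaurentPolynomial.T (-2)

theorem bracket_eq_weightedSum (D : Diagram) :
    D.bracket = weightedSum (bracketWeight ℤ) (bracketLoop ℤ) D.crossings D.arcs := by
  set e : Bool → Smoothing := fun b => if b then .abcd else .adbc with he
  have hinj : Function.Injective e := by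
    intro a b
    cases a <;> cases b <;> simp [he]
  unfold Diagram.bracket weightedSum
  refine Finset.sum_of_injOn (fun σ i => e (σ i)) ?_ ?_ ?_ ?_
  · intro σ _ τ _ h
    funext i
    exact hinj (congrFun h i)
  · intro σ _
    simp
  · intro s _ hs
    -- a state with a virtual smoothing does not contribute
    have : ∃ i, s i = .virt := by
      by_contra! hv
      refine hs ⟨fun i => s i = .abcd, by simp, ?_⟩
      funext i
      have := hv i
      cases h : s i <;> simp_all
    obtain ⟨i, hi⟩ := this
    rw [Finset.prod_eq_zero (Finset.mem_univ i), zero_mul]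
    rw [hi]; rfl
  · intro σ _
    have h1 : ∀ i, (LaurentPolynomial.T (if σ i then 1 else -1) : LaurentPolynomial ℤ) =
        bracketWeight ℤ (D.crossings.get i).type (e (σ i)) := by
      intro i
      cases h : σ i <;> simp [he, bracketWeight]
    simp only [h1]
    rfl

/-- The coefficients of the Kauffman bracket as sparse polynomials. -/
def sparseBracketWeight : CrossingType → Smoothing → SparsePoly ℤ
  | _, .abcd => ⟨[(1, 1)]⟩
  | _, .adbc => ⟨[(-1, 1)]⟩
  | _, .virt => ⟨[]⟩

/-- The value `-A ^ 2 - A ^ (-2)` of a polygon as a sparse polynomial. -/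
def sparseBracketLoop : SparsePoly ℤ := ⟨[(-2, -1), (2, -1)]⟩

theorem isChar_T (R : Type*) [CommRing R] :
    SparsePoly.IsChar (fun n : ℤ => (LaurentPolynomial.T n : LaurentPolynomial R)) where
  one := LaurentPolynomial.T_zero
  mul a b := LaurentPolynomial.T_add a b
  kept a h := by cases h

theorem ev_sparseBracketWeight (t : CrossingType) (s : Smoothing) :
    (sparseBracketWeight t s).ev (fun n : ℤ => (LaurentPolynomial.T n : LaurentPolynomial ℤ)) =
      bracketWeight ℤ t s := by
  cases s <;> simp [sparseBracketWeight, bracketWeight, SparsePoly.ev]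

theorem ev_sparseBracketLoop :
    sparseBracketLoop.ev (fun n : ℤ => (LaurentPolynomial.T n : LaurentPolynomial ℤ)) =
      bracketLoop ℤ := by
  simp [sparseBracketLoop, bracketLoop, SparsePoly.ev]; ring

/-- A computable form of the condition that every label occurs at most twice. -/
def Diagram.fits (D : Diagram) : Bool :=
  (arcEnds D.arcs ++ crossingEnds D.crossings).all
      (fun x => Nat.ble ((arcEnds D.arcs ++ crossingEnds D.crossings).count x) 2)

/-- The contractions of two diagrams succeed and agree. -/
def sameContraction {M : Type} [SparseMonomial M] (w : CrossingType → Smoothing → SparsePoly M)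
    (o : SparsePoly M) (D D' : Diagram) : Bool :=
  D.fits && D'.fits && match contract w o D, contract w o D' with
    | some p, some q => (p - q).isZero
    | _, _ => false

theorem weightedSum_eq_of_sameContraction {M : Type} [SparseMonomial M] {R : Type*} [CommRing R]
    {χ : M → R} {w : CrossingType → Smoothing → R} {o : R}
    {w' : CrossingType → Smoothing → SparsePoly M} {o' : SparsePoly M}
    (hχ : SparsePoly.IsChar χ) (ho : o'.ev χ = o) (hw : ∀ t s, (w' t s).ev χ = w t s)
    {D D' : Diagram} (h : sameContraction w' o' D D' = true) :
    weightedSum w o D.crossings D.arcs = weightedSum w o D'.crossings D'.arcs := by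
  simp only [sameContraction, Bool.and_eq_true] at h
  obtain ⟨⟨h1, h2⟩, h3⟩ := h
  split at h3
  · rename_i p q hp hq
    rw [contract_spec hχ ho hw (fits_of_all h1) hp, contract_spec hχ ho hw (fits_of_all h2) hq,
      SparsePoly.ev_eq h3]
  · cases h3

theorem bracket_eq_of_sameContraction {D D' : Diagram}
    (h : sameContraction sparseBracketWeight sparseBracketLoop D D' = true) :
    D.bracket = D'.bracket := by
  rw [bracket_eq_weightedSum, bracket_eq_weightedSum]
  exact weightedSum_eq_of_sameContraction (isChar_T ℤ) ev_sparseBracketLoop ev_sparseBracketWeight h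

theorem bracket_JS14_eq_unlink2 : JS14.bracket = unlink2.bracket :=
  bracket_eq_of_sameContraction (by decide +kernel)

theorem bracket_T15_eq_unlink2 : T15.bracket = unlink2.bracket :=
  bracket_eq_of_sameContraction (by decide +kernel)

/-! ### Specializations in which the local moves hold -/

section Specialization

variable {M : Type} [SparseMonomial M]

/-- The coefficients of the crossings when the eight variables have the values `v`. -/
def sparseWeight (v : Fin 8 → SparsePoly M) : CrossingType → Smoothing → SparsePoly M
  | .X1, .abcd => v 6 * v 0
  | .X1, .adbc => v 6 * v 1
  | .X1, .virt => v 2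
  | .X2, .abcd => v 6 * v 3
  | .X2, .adbc => v 6 * v 4
  | .X2, .virt => v 5

variable {R : Type*} [CommRing R] {χ : M → R}

theorem ev_sparseWeight (hχ : SparsePoly.IsChar χ) {v : Fin 8 → SparsePoly M} {φ : Ring8 →+* R}
    (hφ : ∀ i, φ (X i) = (v i).ev χ) (t : CrossingType) (s : Smoothing) :
    (sparseWeight v t s).ev χ = φ (weight t s) := by
  cases t <;> cases s <;> simp [sparseWeight, weight, hφ, SparsePoly.ev_mul hχ]

/-- All relations of the local moves hold when the eight variables have the values `v`. -/
def movesHold (v : Fin 8 → SparsePoly M) : Bool :=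
  moves.all fun m => m.exteriors.all fun e =>
    sameContraction (sparseWeight v) (v 7) (m.left.close e) (m.right.close e)

theorem relations_of_movesHold (hχ : SparsePoly.IsChar χ) {v : Fin 8 → SparsePoly M}
    {φ : Ring8 →+* R} (hφ : ∀ i, φ (X i) = (v i).ev χ) (h : movesHold v = true) :
    ∀ p ∈ relations, φ p = 0 := by
  rintro _ ⟨m, hm, e, he, rfl⟩
  have key := List.all_eq_true.mp (List.all_eq_true.mp h m hm) e he
  rw [map_sub, stateSum_eq_weightedSum, stateSum_eq_weightedSum, map_weightedSum,
    map_weightedSum, sub_eq_zero]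
  have hw : (fun t s => φ (weight t s)) = fun t s => (sparseWeight v t s).ev χ := by
    funext t s
    rw [ev_sparseWeight hχ hφ]
  rw [hw, hφ]
  exact weightedSum_eq_of_sameContraction hχ rfl (fun _ _ => rfl) key

theorem idealInf_le_ker [Algebra ℚ R] (hχ : SparsePoly.IsChar χ) {v : Fin 8 → SparsePoly M}
    (h : movesHold v = true) {f : MvPolynomial (Fin 8) ℚ} (hf : f ∈ idealInf) :
    aeval (fun i => (v i).ev χ) f = 0 := by
  have hle : idealInf ≤ RingHom.ker (aeval (R := ℚ) (fun i => (v i).ev χ)).toRingHom := by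
    refine Ideal.span_le.mpr ?_
    rintro _ ⟨p, hp, rfl⟩
    refine relations_of_movesHold hχ (φ := (aeval (R := ℚ) (fun i => (v i).ev χ)).toRingHom.comp
      toRat) (fun i => ?_) h p hp
    simp [toRat]
  exact hle hf

end Specialization

/-! ### The VSE-invariant determines the bracket -/

theorem normalForm_spec (I : Ideal (MvPolynomial (Fin 8) ℚ)) (p : MvPolynomial (Fin 8) ℚ) :
    IsNormalForm I p (normalForm I p) := (exists_isNormalForm I p).choose_spec

theorem sub_mem_of_normalForm_eq {I : Ideal (MvPolynomial (Fin 8) ℚ)}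
    {p q : MvPolynomial (Fin 8) ℚ} (h : normalForm I p = normalForm I q) : p - q ∈ I := by
  have := I.sub_mem (normalForm_spec I p).1 (normalForm_spec I q).1
  rwa [h, sub_sub_sub_cancel_right] at this

/-- The values of the variables for which the state sum is the Kauffman bracket: both types of
crossings have the coefficients `A` and `A⁻¹`, and the virtual terms vanish. -/
def bracketPoint : Fin 8 → SparsePoly ℤ :=
  ![⟨[(1, 1)]⟩, ⟨[(-1, 1)]⟩, ⟨[]⟩, ⟨[(1, 1)]⟩, ⟨[(-1, 1)]⟩, ⟨[]⟩, ⟨[(0, 1)]⟩, sparseBracketLoop]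

theorem movesHold_bracketPoint : movesHold bracketPoint = true := by decide +kernel

/-- At `bracketPoint`, the state sum is the bracket; over `ℚ`, since `𝓘_∞` is an ideal over `ℚ`. -/
theorem aeval_bracketPoint (D : Diagram) :
    aeval (R := ℚ) (fun i => (bracketPoint i).ev
      (fun n : ℤ => (LaurentPolynomial.T n : LaurentPolynomial ℚ))) (toRat D.stateSum) =
      AddMonoidAlgebra.mapRingHom ℤ (Int.castRingHom ℚ) D.bracket := by
  set χ := fun n : ℤ => (LaurentPolynomial.T n : LaurentPolynomial ℚ) with hχ
  change ((aeval (R := ℚ) (fun i => (bracketPoint i).ev χ)).toRingHom.comp toRat) D.stateSum = _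
  rw [bracket_eq_weightedSum, stateSum_eq_weightedSum, map_weightedSum, map_weightedSum]
  have hT : ∀ n : ℤ, AddMonoidAlgebra.mapRingHom ℤ (Int.castRingHom ℚ) (LaurentPolynomial.T n) =
      (LaurentPolynomial.T n : LaurentPolynomial ℚ) := by
    intro n
    rw [LaurentPolynomial.T, LaurentPolynomial.T, AddMonoidAlgebra.mapRingHom_single, map_one]
  congr 1
  · funext t s
    cases t <;> cases s <;>
      simp [weight, toRat, bracketPoint, bracketWeight, SparsePoly.ev, hT, hχ]
  · simp [toRat, bracketPoint, bracketLoop, sparseBracketLoop, SparsePoly.ev, hT, hχ]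
    ring

theorem bracket_eq_of_etaInf_eq {D D' : Diagram} (h : etaInf D = etaInf D') :
    D.bracket = D'.bracket := by
  have h1 := idealInf_le_ker (isChar_T ℚ) movesHold_bracketPoint (sub_mem_of_normalForm_eq h)
  rw [map_sub, aeval_bracketPoint, aeval_bracketPoint, sub_eq_zero] at h1
  refine AddMonoidAlgebra.ext (Finsupp.ext fun n => ?_)
  have := congrArg (fun p : LaurentPolynomial ℚ => p.coeff n) h1
  simpa using this

end VSE

namespace VSE

/-! ### Specializations modulo a cube -/

/-- A monomial `s ^ i * t ^ j`, where `s ^ 3 = 0`. -/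
structure JetMonomial where
  s : ℕ
  t : ℕ

instance : SparseMonomial JetMonomial where
  one := ⟨0, 0⟩
  mul a b := ⟨a.s + b.s, a.t + b.t⟩
  cmp a b := cmpNat a.s b.s (cmpNat a.t b.t .eq)
  kept a := Nat.ble a.s 2
  eq_of_cmp {a b} h := by
    obtain ⟨h1, h⟩ := eq_of_cmpNat h
    obtain ⟨h2, -⟩ := eq_of_cmpNat h
    cases a; cases b; simp_all

/-- The monomial `s ^ i * t ^ j` as an element of `ℚ[t][s]`. -/
noncomputable def jetChar (a : JetMonomial) : Polynomial (Polynomial ℚ) :=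
  Polynomial.C (Polynomial.X ^ a.t) * Polynomial.X ^ a.s

/-- The ring `ℚ[t][s] / (s ^ 3)`. -/
abbrev JetRing :=
  Polynomial (Polynomial ℚ) ⧸ Ideal.span {(Polynomial.X ^ 3 : Polynomial (Polynomial ℚ))}

theorem isChar_jet : SparsePoly.IsChar (R := JetRing)
    (fun a => Ideal.Quotient.mk _ (jetChar a)) where
  one := by simp [jetChar, SparseMonomial.one]
  mul a b := by
    rw [← map_mul]
    congr 1
    simp only [jetChar, SparseMonomial.mul, pow_add, map_mul]
    ring
  kept a h := by
    have h3 : 3 ≤ a.s := by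
      have : ¬ a.s ≤ 2 := fun hle => by
        rw [show SparseMonomial.kept a = Nat.ble a.s 2 from rfl, Nat.ble_eq_true_of_le hle] at h
        cases h
      omega
    rw [Ideal.Quotient.eq_zero_iff_mem, Ideal.mem_span_singleton]
    exact Dvd.dvd.mul_left (pow_dvd_pow _ h3) _

/-- If the local moves hold modulo `s ^ 3` at a point with `M = s`, then the elements of `𝓘_2`
vanish modulo `s ^ 3` at this point. -/
theorem dvd_aeval_of_mem_idealAt {v : Fin 8 → SparsePoly JetMonomial} (h : movesHold v = true)
    (hM : (v 6).ev jetChar = Polynomial.X) {f : MvPolynomial (Fin 8) ℚ} (hf : f ∈ idealAt 2) :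
    Polynomial.X ^ 3 ∣ aeval (R := ℚ) (fun i => (v i).ev jetChar) f := by
  set J := Ideal.span {(Polynomial.X ^ 3 : Polynomial (Polynomial ℚ))}
  have hcomp : ∀ g : MvPolynomial (Fin 8) ℚ,
      aeval (R := ℚ) (fun i => (v i).ev (R := JetRing)
        (fun a => Ideal.Quotient.mk J (jetChar a))) g =
      Ideal.Quotient.mkₐ ℚ J (aeval (R := ℚ) (fun i => (v i).ev jetChar) g) := by
    have h1 : aeval (R := ℚ) (fun i => (v i).ev (R := JetRing)
        (fun a => Ideal.Quotient.mk J (jetChar a))) =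
        (Ideal.Quotient.mkₐ ℚ J).comp (aeval (R := ℚ) (fun i => (v i).ev jetChar)) := by
      refine MvPolynomial.algHom_ext fun i => ?_
      simp [SparsePoly.ev, map_list_sum, List.map_map, Function.comp_def]
    exact fun g => DFunLike.congr_fun h1 g
  rw [← Ideal.mem_span_singleton]
  have hle : idealAt 2 ≤
      J.comap (aeval (R := ℚ) (fun i => (v i).ev jetChar)).toRingHom := by
    refine sup_le (fun g hg => ?_) (Ideal.span_le.mpr ?_)
    · have h1 := idealInf_le_ker isChar_jet h hg
      rw [hcomp] at h1
      exact Ideal.Quotient.eq_zero_iff_mem (I := J).mp h1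
    · rintro _ rfl
      refine Ideal.mem_span_singleton.mpr ?_
      simp [hM]
  exact hle hf

/-- The coefficient of `s ^ a * t ^ b` in the value of a polynomial at a point of `ℚ[t][s]`. -/
noncomputable def jetCoeff (v : Fin 8 → SparsePoly JetMonomial) (a b : ℕ) :
    MvPolynomial (Fin 8) ℚ →ₗ[ℚ] ℚ :=
  Polynomial.lcoeff ℚ b ∘ₗ (Polynomial.lcoeff (Polynomial ℚ) a).restrictScalars ℚ ∘ₗ
    (aeval (R := ℚ) (fun i => (v i).ev jetChar)).toLinearMap

theorem jetCoeff_eq_zero {v : Fin 8 → SparsePoly JetMonomial} (h : movesHold v = true)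
    (hM : (v 6).ev jetChar = Polynomial.X) {a : ℕ} (ha : a < 3) (b : ℕ)
    {f : MvPolynomial (Fin 8) ℚ} (hf : f ∈ idealAt 2) : jetCoeff v a b f = 0 := by
  have := Polynomial.X_pow_dvd_iff.mp (dvd_aeval_of_mem_idealAt h hM hf) a ha
  simp [jetCoeff, this]

/-- For `o = 1`, all smoothings of a crossing have the same effect on a state sum, so that only the
sums of the coefficients of the crossings matter, which are `1` at this point. For `o = 0`, all
state sums vanish. -/
def pointOne (o : ℤ) : Fin 8 → SparsePoly JetMonomial :=
  ![⟨[]⟩, ⟨[]⟩, 1, ⟨[(⟨0, 1⟩, -1)]⟩, ⟨[]⟩, ⟨[(⟨0, 0⟩, 1), (⟨1, 1⟩, 1)]⟩, ⟨[(⟨1, 0⟩, 1)]⟩,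
    SparsePoly.const o]

/-- For `o = -2`, the three smoothings of a crossing add up to zero in every state sum, so that the
same multiple of `s * t` may be added to the coefficients of all three smoothings. -/
def pointNegTwo : Fin 8 → SparsePoly JetMonomial :=
  ![⟨[]⟩, ⟨[]⟩, 1, ⟨[(⟨0, 1⟩, 1)]⟩, ⟨[(⟨0, 1⟩, 1)]⟩, ⟨[(⟨0, 0⟩, 1), (⟨1, 1⟩, 1)]⟩,
    ⟨[(⟨1, 0⟩, 1)]⟩, SparsePoly.const (-2)]

/-- For `o = 2`, there are points with `-A = B = -X = Y = 2 * t` and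
`F = Z = e * (1 + 2 * s ^ 2 * t ^ 2)`, where `e` is a sign. Here `Z` has no term of first order in `s`,
so that the two signs are needed to tell the powers of `Z` apart. -/
def pointTwo (e : ℤ) : Fin 8 → SparsePoly JetMonomial :=
  ![⟨[(⟨0, 1⟩, -2)]⟩, ⟨[(⟨0, 1⟩, 2)]⟩, ⟨[(⟨0, 0⟩, e), (⟨2, 2⟩, 2 * e)]⟩,
    ⟨[(⟨0, 1⟩, -2)]⟩, ⟨[(⟨0, 1⟩, 2)]⟩, ⟨[(⟨0, 0⟩, e), (⟨2, 2⟩, 2 * e)]⟩,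
    ⟨[(⟨1, 0⟩, 1)]⟩, SparsePoly.const 2]

theorem movesHold_pointOne_zero : movesHold (pointOne 0) = true := by decide +kernel
theorem movesHold_pointOne_one : movesHold (pointOne 1) = true := by decide +kernel
theorem movesHold_pointNegTwo : movesHold pointNegTwo = true := by decide +kernel
theorem movesHold_pointTwo : ∀ e ∈ [1, -1], movesHold (pointTwo e) = true := by decide +kernel

end VSE

namespace VSE

/-! ### The monomials `Z ^ i * o ^ j` with `i ≤ 2` and `j ≤ 3` are reduced -/

theorem ev_const_jet (c : ℤ) : (SparsePoly.const c : SparsePoly JetMonomial).ev jetChar =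
    (c : Polynomial (Polynomial ℚ)) := by
  rw [SparsePoly.const]
  split_ifs with h
  · simp [SparsePoly.ev, h]
  · simp [SparsePoly.ev, jetChar, SparseMonomial.one]

theorem jetCoeff_apply (v : Fin 8 → SparsePoly JetMonomial) (a b k l n : ℕ) {c : ℤ}
    (hM : (v 6).ev jetChar = Polynomial.X) (ho : (v 7).ev jetChar = c) :
    jetCoeff v a b (X 5 ^ k * X 6 ^ l * X 7 ^ n) =
      (((v 5).ev jetChar ^ k * Polynomial.X ^ l).coeff a).coeff b * c ^ n := by
  simp only [jetCoeff, LinearMap.comp_apply, AlgHom.toLinearMap_apply, map_mul, map_pow, aeval_X,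
    hM, ho, LinearMap.coe_restrictScalars, Polynomial.lcoeff_apply]
  rw [← Int.cast_pow, Polynomial.coeff_mul_intCast, ← Int.cast_pow, Polynomial.coeff_mul_intCast]

/-- At a point with `Z = 1 + s * t`, the coefficient of `s ^ i * t ^ i` singles out the monomials
with the factor `Z ^ i` among those that can occur. -/
theorem jetCoeff_of_line {v : Fin 8 → SparsePoly JetMonomial} {c : ℤ}
    (hZ : (v 5).ev jetChar = 1 + Polynomial.C Polynomial.X * Polynomial.X)
    (hM : (v 6).ev jetChar = Polynomial.X) (ho : (v 7).ev jetChar = c) {i k : ℕ} (hi : i ≤ 2)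
    (hk : k ≤ i) (l n : ℕ) (hl : k = i → l = 0) :
    jetCoeff v i i (X 5 ^ k * X 6 ^ l * X 7 ^ n) = if k = i then (c : ℚ) ^ n else 0 := by
  rw [jetCoeff_apply v i i k l n hM ho, hZ]
  have key : (((1 + Polynomial.C Polynomial.X * Polynomial.X : Polynomial (Polynomial ℚ)) ^ k *
      Polynomial.X ^ l).coeff i).coeff i = if k = i then 1 else 0 := by
    have h2 : (1 + Polynomial.C Polynomial.X * Polynomial.X : Polynomial (Polynomial ℚ)) ^ 2 =
      Polynomial.C (Polynomial.X ^ 2) * Polynomial.X ^ 2 +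
        Polynomial.C (2 * Polynomial.X) * Polynomial.X + 1 := by
      simp only [map_mul, map_pow, map_ofNat]; ring
    rw [Polynomial.coeff_mul_X_pow']
    interval_cases i <;> interval_cases k <;> simp at hl <;>
      simp [h2, hl, Polynomial.coeff_X, Polynomial.coeff_one]
    · split_ifs <;> simp [Polynomial.coeff_one]
    · split_ifs <;> simp [Polynomial.coeff_one]
    · split_ifs <;> simp [Polynomial.coeff_X, Polynomial.coeff_one]
    · rw [← map_pow, Polynomial.coeff_C_mul, Polynomial.coeff_X_pow, if_pos rfl, mul_one,
        Polynomial.coeff_X_pow, if_pos rfl]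
  rw [key]
  split_ifs <;> simp

/-- For `Z = e * (1 + 2 * s ^ 2 * t ^ 2)`, the coefficient of `s ^ 2 * t ^ 2` is `2 * k * e ^ k` on
`Z ^ k`. -/
theorem jetCoeff_pointTwo {e : ℤ} (he : e ^ 2 = 1) {k : ℕ} (hk : k ≤ 2) (l n : ℕ)
    (hl : k = 2 → l = 0) :
    jetCoeff (pointTwo e) 2 2 (X 5 ^ k * X 6 ^ l * X 7 ^ n) =
      (if k = 2 then 4 else if k = 1 ∧ l = 0 then 2 * (e : ℚ) else 0) * 2 ^ n := by
  have hZ : (pointTwo e 5).ev jetChar = Polynomial.monomial 0 (Polynomial.monomial 0 (e : ℚ)) +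
      Polynomial.monomial 2 (Polynomial.monomial 2 (2 * (e : ℚ))) := by
    have h2 : Polynomial.C (Polynomial.C (2 : ℚ)) = 2 := rfl
    simp [pointTwo, SparsePoly.ev, jetChar, ← Polynomial.C_mul_X_pow_eq_monomial, h2]; ring
  rw [jetCoeff_apply (c := 2) _ 2 2 k l n (by simp [pointTwo, SparsePoly.ev, jetChar])
    (ev_const_jet 2), hZ]
  have he' : (e : ℚ) * e = 1 := by rw [← pow_two]; exact_mod_cast he
  congr 1
  interval_cases k
  · rw [pow_zero, one_mul, Polynomial.coeff_X_pow, if_neg (by omega : ¬ ((0 : ℕ) = 2)),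
      if_neg (by omega : ¬ ((0 : ℕ) = 1 ∧ l = 0))]
    split_ifs <;> simp [Polynomial.coeff_one]
  · rw [pow_one, add_mul, Polynomial.monomial_mul_X_pow, Polynomial.monomial_mul_X_pow,
      Polynomial.coeff_add, Polynomial.coeff_monomial, Polynomial.coeff_monomial,
      if_neg (by omega : ¬ (1 = 2))]
    have h0 : (Polynomial.monomial 0 (e : ℚ)).coeff 2 = 0 := by
      rw [Polynomial.coeff_monomial, if_neg (by omega)]
    rcases Nat.eq_zero_or_pos l with rfl | hpos
    · simp only [zero_add, if_neg (by omega : ¬ (0 = 2)), add_zero, if_true, and_self,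
        Polynomial.coeff_monomial]
    · rw [if_neg (by omega : ¬ (2 + l = 2)), if_neg (by omega : ¬ (1 = 1 ∧ l = 0)), add_zero]
      split_ifs
      · exact h0
      · exact Polynomial.coeff_zero 2
  · rw [hl rfl, pow_zero, mul_one, pow_two]
    simp only [add_mul, mul_add, Polynomial.monomial_mul_monomial, Polynomial.coeff_add,
      Polynomial.coeff_monomial]
    simp
    linear_combination 4 * he'

/-- On the monomials that are lexicographically at most `Z ^ i * o ^ j`, there are functionals that
vanish on `𝓘_2`, ignore the lower powers of `Z`, and evaluate at `o = c`. -/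
theorem exists_functional {i : ℕ} (hi : i ≤ 2) {c : ℤ} (hc : c ∈ [0, 1, -2, 2]) :
    ∃ Λ : MvPolynomial (Fin 8) ℚ →ₗ[ℚ] ℚ, (∀ f ∈ idealAt 2, Λ f = 0) ∧
      ∃ r : ℚ, r ≠ 0 ∧ ∀ k l n : ℕ, k ≤ i → (k = i → l = 0) →
        Λ (X 5 ^ k * X 6 ^ l * X 7 ^ n) = if k = i then r * (c : ℚ) ^ n else 0 := by
  have hline : ∀ v : Fin 8 → SparsePoly JetMonomial, movesHold v = true →
      (v 5).ev jetChar = 1 + Polynomial.C Polynomial.X * Polynomial.X →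
      (v 6).ev jetChar = Polynomial.X → v 7 = SparsePoly.const c →
      ∃ Λ : MvPolynomial (Fin 8) ℚ →ₗ[ℚ] ℚ, (∀ f ∈ idealAt 2, Λ f = 0) ∧
      ∃ r : ℚ, r ≠ 0 ∧ ∀ k l n : ℕ, k ≤ i → (k = i → l = 0) →
        Λ (X 5 ^ k * X 6 ^ l * X 7 ^ n) = if k = i then r * (c : ℚ) ^ n else 0 := by
    intro v h hZ hM ho
    refine ⟨jetCoeff v i i, fun f hf => jetCoeff_eq_zero h hM (by omega) i hf, 1, one_ne_zero,
      fun k l n hk hl => ?_⟩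
    rw [jetCoeff_of_line hZ hM (by rw [ho, ev_const_jet]) hi hk l n hl, one_mul]
  simp only [List.mem_cons, List.not_mem_nil, or_false] at hc
  rcases hc with rfl | rfl | rfl | rfl
  · refine hline _ movesHold_pointOne_zero ?_ ?_ rfl <;>
      simp [pointOne, SparsePoly.ev, jetChar]
  · refine hline _ movesHold_pointOne_one ?_ ?_ rfl <;>
      simp [pointOne, SparsePoly.ev, jetChar]
  · refine hline _ movesHold_pointNegTwo ?_ ?_ rfl <;>
      simp [pointNegTwo, SparsePoly.ev, jetChar]
  · have h1 := movesHold_pointTwo 1 (by simp)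
    have h2 := movesHold_pointTwo (-1) (by simp)
    have hM : ∀ e, (pointTwo e 6).ev jetChar = Polynomial.X := fun e => by
      simp [pointTwo, SparsePoly.ev, jetChar]
    have e1 : (1 : ℤ) ^ 2 = 1 := by norm_num
    have e2 : (-1 : ℤ) ^ 2 = 1 := by norm_num
    have hz1 := fun f hf => jetCoeff_eq_zero (f := f) h1 (hM 1) (by norm_num : 2 < 3) 2 hf
    have hz2 := fun f hf => jetCoeff_eq_zero (f := f) h2 (hM (-1)) (by norm_num : 2 < 3) 2 hf
    interval_cases i
    · refine ⟨jetCoeff (pointTwo 1) 0 0, fun f hf => jetCoeff_eq_zero h1 (hM 1) (by norm_num) 0 hf,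
        1, one_ne_zero, fun k l n hk hl => ?_⟩
      obtain rfl : k = 0 := by omega
      obtain rfl := hl rfl
      rw [jetCoeff_apply (c := 2) _ 0 0 0 0 n (hM 1) (ev_const_jet 2)]
      simp
    · refine ⟨jetCoeff (pointTwo 1) 2 2, hz1, 2, two_ne_zero, fun k l n hk hl => ?_⟩
      rw [jetCoeff_pointTwo e1 (by omega) l n (by omega), if_neg (by omega)]
      split_ifs <;> simp_all
    · -- the two signs are combined so that odd powers of `Z` cancel
      refine ⟨jetCoeff (pointTwo 1) 2 2 + jetCoeff (pointTwo (-1)) 2 2,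
        fun f hf => by rw [LinearMap.add_apply, hz1 f hf, hz2 f hf, add_zero], 8, by norm_num,
        fun k l n hk hl => ?_⟩
      rw [LinearMap.add_apply, jetCoeff_pointTwo e1 hk l n hl, jetCoeff_pointTwo e2 hk l n hl]
      push_cast
      split_ifs <;> ring

theorem toLex_le_of_mem_support {f : MvPolynomial (Fin 8) ℚ} {m : Fin 8 →₀ ℕ}
    (hm : m ∈ f.support) : toLex m ≤ toLex (MonomialOrder.lex.degree f) :=
  MonomialOrder.lex_le_iff.mp (MonomialOrder.le_degree hm)

/-- A monomial that is lexicographically at most `Z ^ i * o ^ j`. -/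
theorem exponents_of_lex_le {m d : Fin 8 →₀ ℕ} (h : toLex m ≤ toLex d)
    (hd : ∀ x : Fin 8, x < 5 → d x = 0) (hd6 : d 6 = 0) :
    (∀ x : Fin 8, x < 5 → m x = 0) ∧ m 5 ≤ d 5 ∧ (m 5 = d 5 → m 6 = 0 ∧ m 7 ≤ d 7) := by
  rcases h.eq_or_lt with h | h
  · obtain rfl : m = d := toLex_inj.mp h
    exact ⟨hd, le_rfl, fun _ => ⟨hd6, le_rfl⟩⟩
  · obtain ⟨x, hx, hlt⟩ := Finsupp.Lex.lt_iff.mp h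
    simp only [ofLex_toLex] at hx hlt
    have hx5 : ¬ x < 5 := fun hx' => by rw [hd x hx'] at hlt; omega
    have h0 : ∀ y : Fin 8, y < 5 → m y = 0 := fun y hy => by
      rw [hx y (by omega), hd y hy]
    refine ⟨h0, ?_⟩
    have : x = 5 ∨ x = 6 ∨ x = 7 := by omega
    rcases this with rfl | rfl | rfl
    · exact ⟨hlt.le, fun h' => by omega⟩
    · omega
    · have h5 := hx 5 (by decide)
      have h6 := hx 6 (by decide)
      exact ⟨h5.le, fun _ => ⟨by omega, hlt.le⟩⟩

theorem monomial_eq_of_exponents {m : Fin 8 →₀ ℕ} (h0 : ∀ x : Fin 8, x < 5 → m x = 0) (c : ℚ) :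
    monomial m c = c • (X 5 ^ m 5 * X 6 ^ m 6 * X 7 ^ m 7) := by
  rw [MvPolynomial.monomial_eq, Finsupp.prod_fintype _ _ (by simp), MvPolynomial.smul_eq_C_mul]
  simp [Fin.prod_univ_eight, h0 0 (by decide), h0 1 (by decide), h0 2 (by decide),
    h0 3 (by decide), h0 4 (by decide)]

/-- No leading monomial of an element of `𝓘_2` divides `Z ^ 2 * o ^ 3`. Otherwise, the functionals
of `exists_functional` would give a nonzero polynomial of degree at most `3` in `o` with the
roots `0`, `1`, `-2` and `2`. -/
theorem not_degree_le {f : MvPolynomial (Fin 8) ℚ} (hf : f ∈ idealAt 2) (hf0 : f ≠ 0)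
    {c : Fin 8 →₀ ℕ} (hc : ∀ x : Fin 8, x < 5 → c x = 0) (hc5 : c 5 ≤ 2) (hc6 : c 6 = 0)
    (hc7 : c 7 ≤ 3) : ¬ MonomialOrder.lex.degree f ≤ c := by
  intro hle
  set d := MonomialOrder.lex.degree f with hd
  have hdc : ∀ x, d x ≤ c x := fun x => hle x
  have hd0 : ∀ x : Fin 8, x < 5 → d x = 0 := fun x hx => by
    have := hdc x; rw [hc x hx] at this; omega
  have hd5 : d 5 ≤ 2 := (hdc 5).trans hc5
  have hd6 : d 6 = 0 := by have := hdc 6; omega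
  have hd7 : d 7 ≤ 3 := (hdc 7).trans hc7
  have hsupp : ∀ m ∈ f.support,
      (∀ x : Fin 8, x < 5 → m x = 0) ∧ m 5 ≤ d 5 ∧ (m 5 = d 5 → m 6 = 0 ∧ m 7 ≤ d 7) :=
    fun m hm => exponents_of_lex_le (toLex_le_of_mem_support hm) hd0 hd6
  -- the coefficients of the monomials with the highest power of `Z`
  let e : ℕ → Fin 8 →₀ ℕ := fun n => Finsupp.single 5 (d 5) + Finsupp.single 7 n
  have he5 : ∀ n, e n 5 = d 5 := fun n => by simp [e]
  have he7 : ∀ n, e n 7 = n := fun n => by simp [e]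
  have hme : ∀ m ∈ f.support, m 5 = d 5 → m = e (m 7) := by
    intro m hm h5
    obtain ⟨h0, -, h6⟩ := hsupp m hm
    ext x
    by_cases hx : x < 5
    · rw [h0 x hx]
      have h1 : (5 : Fin 8) ≠ x := by rintro rfl; exact absurd hx (by decide)
      have h2 : (7 : Fin 8) ≠ x := by rintro rfl; exact absurd hx (by decide)
      simp [e, h1, h2]
    · have : x = 5 ∨ x = 6 ∨ x = 7 := by omega
      rcases this with rfl | rfl | rfl
      · rw [h5, he5]
      · simp [e, (h6 h5).1]
      · rw [he7]
  have key : ∀ c ∈ ([0, 1, -2, 2] : List ℤ),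
      ∑ n ∈ Finset.range 4, f.coeff (e n) * (c : ℚ) ^ n = 0 := by
    intro c hc
    obtain ⟨Λ, hΛ, r, hr, hval⟩ := exists_functional hd5 hc
    have h1 : Λ f = ∑ m ∈ f.support, if m 5 = d 5 then f.coeff m * (r * (c : ℚ) ^ m 7) else 0 := by
      conv_lhs => rw [f.as_sum, map_sum]
      refine Finset.sum_congr rfl fun m hm => ?_
      obtain ⟨h0, h5, h6⟩ := hsupp m hm
      rw [monomial_eq_of_exponents h0, map_smul, hval _ _ _ h5 (fun h => (h6 h).1), smul_eq_mul]
      split_ifs <;> ring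
    rw [hΛ f hf, ← Finset.sum_filter] at h1
    have h2 : ∑ m ∈ f.support with m 5 = d 5, f.coeff m * (r * (c : ℚ) ^ m 7) =
        ∑ n ∈ Finset.range 4, f.coeff (e n) * (r * (c : ℚ) ^ n) := by
      refine Finset.sum_of_injOn (fun m => m 7) ?_ ?_ ?_ ?_
      · intro m hm m' hm' h
        simp only [Finset.coe_filter, Set.mem_ofPred_eq] at hm hm'
        rw [hme m hm.1 hm.2, hme m' hm'.1 hm'.2]
        exact congrArg e h
      · intro m hm
        simp only [Finset.coe_filter, Set.mem_ofPred_eq] at hm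
        have := ((hsupp m hm.1).2.2 hm.2).2
        simp only [Finset.coe_range, Set.mem_Iio]; omega
      · intro n _ hn
        have : f.coeff (e n) = 0 := by
          by_contra h
          refine hn ⟨e n, ?_, he7 n⟩
          simp only [Finset.coe_filter, Set.mem_ofPred_eq]
          exact ⟨MvPolynomial.mem_support_iff.mpr h, he5 n⟩
        rw [this, zero_mul]
      · intro m hm
        rw [Finset.mem_filter] at hm
        rw [← hme m hm.1 hm.2]
    rw [h2] at h1
    refine (mul_eq_zero.mp ?_).resolve_left hr
    rw [h1, Finset.mul_sum]
    exact Finset.sum_congr rfl fun n _ => by ring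
  have k0 := key 0 (by simp)
  have k1 := key 1 (by simp)
  have k2 := key (-2) (by simp)
  have k3 := key 2 (by simp)
  simp only [Finset.sum_range_succ, Finset.sum_range_zero] at k0 k1 k2 k3
  norm_num at k0 k1 k2 k3
  have hde : d = e (d 7) := by
    have hdm : d ∈ f.support := MonomialOrder.degree_mem_support hf0
    exact hme d hdm rfl
  have hne : f.coeff d ≠ 0 := MvPolynomial.mem_support_iff.mp (MonomialOrder.degree_mem_support hf0)
  rw [hde] at hne
  generalize d 7 = n at hd7 hne
  interval_cases n <;> refine hne ?_ <;> linarith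

/-- Polynomials in `Z` and `o` of small degrees are normal forms modulo `𝓘_2`. -/
theorem eta_two_eq {D : Diagram} {r : MvPolynomial (Fin 8) ℚ}
    (h : toRat D.stateSum - r ∈ idealAt 2)
    (hr : ∀ c ∈ r.support, (∀ x : Fin 8, x < 5 → c x = 0) ∧ c 5 ≤ 2 ∧ c 6 = 0 ∧ c 7 ≤ 3) :
    eta 2 D = r := by
  refine isNormalForm_unique (idealAt 2) _ _ _ (normalForm_spec _ _) ⟨h, fun c hc f hf hf0 => ?_⟩
  obtain ⟨h1, h2, h3, h4⟩ := hr c hc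
  exact not_degree_le hf hf0 h1 h2 h3 h4

end VSE

namespace VSE

/-! ### Rewriting sparse polynomials -/

namespace SparsePoly

variable {M : Type} {R : Type*} [CommRing R] {χ : M → R}

/-- Splits a list of terms into the terms on which the partial function `f` is undefined, and the
images of the others. -/
def split (f : M → Option M) : List (M × ℤ) → List (M × ℤ) × List (M × ℤ)
  | [] => ([], [])
  | (a, c) :: l =>
    match f a with
    | none => ((a, c) :: (split f l).1, (split f l).2)
    | some b => ((split f l).1, (b, c) :: (split f l).2)

theorem ev_split {f : M → Option M} {v : R} (hf : ∀ a b, f a = some b → χ a = v * χ b)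
    (l : List (M × ℤ)) : ev χ ⟨(split f l).1⟩ + v * ev χ ⟨(split f l).2⟩ = ev χ ⟨l⟩ := by
  induction l with
  | nil => simp [split, ev_mk_nil]
  | cons t l ih =>
    obtain ⟨a, c⟩ := t
    rw [split, ev_mk_cons, ← ih]
    split
    · rw [ev_mk_cons]; ring
    · rename_i b hb
      rw [ev_mk_cons, hf a b hb]; ring

variable [SparseMonomial M]

/-- Replaces a power of a monomial by a power of the polynomial `q`, where `f` divides by the
monomial, with a bound on the exponent. -/
def replace (f : M → Option M) (q : SparsePoly M) : ℕ → SparsePoly M → SparsePoly M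
  | 0, p => p
  | n + 1, p =>
    let s := split f p.1
    match s.2 with
    | [] => p
    | _ :: _ => ⟨s.1⟩ + q * replace f q n ⟨s.2⟩

theorem ev_replace (hχ : IsChar χ) {f : M → Option M} {q : SparsePoly M}
    (hf : ∀ a b, f a = some b → χ a = q.ev χ * χ b) (n : ℕ) (p : SparsePoly M) :
    (replace f q n p).ev χ = p.ev χ := by
  induction n generalizing p with
  | zero => rfl
  | succ n ih =>
    simp only [replace]
    split
    · rfl
    · rw [ev_add, ev_mul hχ, ih, ev_split hf]

end SparsePoly

/-! ### State sums modulo `M ^ 3` -/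

/-- A monomial `F ^ f * (M X) ^ x * (M Y) ^ y * (M A) ^ a * (M B) ^ b * Z ^ z * o ^ o`. -/
structure StateMonomial where
  f : ℕ
  x : ℕ
  y : ℕ
  a : ℕ
  b : ℕ
  z : ℕ
  o : ℕ

/-- The monomials that vanish modulo `M ^ 3` are dropped. -/
instance : SparseMonomial StateMonomial where
  one := ⟨0, 0, 0, 0, 0, 0, 0⟩
  mul m n := ⟨m.f + n.f, m.x + n.x, m.y + n.y, m.a + n.a, m.b + n.b, m.z + n.z, m.o + n.o⟩
  cmp m n := cmpNat m.f n.f (cmpNat m.x n.x (cmpNat m.y n.y (cmpNat m.a n.a (cmpNat m.b n.b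
    (cmpNat m.z n.z (cmpNat m.o n.o .eq))))))
  kept m := Nat.ble (m.x + m.y + m.a + m.b) 2
  eq_of_cmp {m n} h := by
    obtain ⟨h1, h⟩ := eq_of_cmpNat h
    obtain ⟨h2, h⟩ := eq_of_cmpNat h
    obtain ⟨h3, h⟩ := eq_of_cmpNat h
    obtain ⟨h4, h⟩ := eq_of_cmpNat h
    obtain ⟨h5, h⟩ := eq_of_cmpNat h
    obtain ⟨h6, h⟩ := eq_of_cmpNat h
    obtain ⟨h7, -⟩ := eq_of_cmpNat h
    cases m; cases n; simp_all

/-- The monomial as a polynomial. -/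
noncomputable def stateChar (m : StateMonomial) : MvPolynomial (Fin 8) ℚ :=
  X 2 ^ m.f * (X 6 * X 3) ^ m.x * (X 6 * X 4) ^ m.y * (X 6 * X 0) ^ m.a * (X 6 * X 1) ^ m.b *
    X 5 ^ m.z * X 7 ^ m.o

theorem stateChar_one : stateChar SparseMonomial.one = 1 := by
  simp [stateChar, SparseMonomial.one]

theorem stateChar_mul (m n : StateMonomial) :
    stateChar (SparseMonomial.mul m n) = stateChar m * stateChar n := by
  simp only [stateChar, SparseMonomial.mul, pow_add]
  ring

theorem dvd_stateChar (m : StateMonomial) : X 6 ^ (m.x + m.y + m.a + m.b) ∣ stateChar m := by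
  refine ⟨X 2 ^ m.f * X 3 ^ m.x * X 4 ^ m.y * X 0 ^ m.a * X 1 ^ m.b * X 5 ^ m.z * X 7 ^ m.o, ?_⟩
  simp only [stateChar, mul_pow, pow_add]
  ring

theorem stateChar_f {m : StateMonomial} {n : ℕ} (h : m.f = n + 1) :
    stateChar m = X 2 * stateChar { m with f := n } := by
  simp only [stateChar, h, pow_succ]
  ring

theorem stateChar_z {m : StateMonomial} {n : ℕ} (h : m.z = n + 2) :
    stateChar m = X 5 ^ 2 * stateChar { m with z := n } := by
  simp only [stateChar, h, pow_add]
  ring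

theorem isChar_stateChar {K : Ideal (MvPolynomial (Fin 8) ℚ)} (hK : X 6 ^ 3 ∈ K) :
    SparsePoly.IsChar fun m => Ideal.Quotient.mk K (stateChar m) where
  one := by rw [stateChar_one, map_one]
  mul m n := by rw [stateChar_mul, map_mul]
  kept m h := by
    have h3 : 3 ≤ m.x + m.y + m.a + m.b := by
      have : ¬ m.x + m.y + m.a + m.b ≤ 2 := fun hle => by
        rw [show SparseMonomial.kept m = Nat.ble (m.x + m.y + m.a + m.b) 2 from rfl,
          Nat.ble_eq_true_of_le hle] at h
        cases h
      omega
    rw [Ideal.Quotient.eq_zero_iff_mem]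
    exact K.mem_of_dvd ((pow_dvd_pow _ h3).trans (dvd_stateChar m)) hK

theorem mk_ev_stateChar (K : Ideal (MvPolynomial (Fin 8) ℚ)) (p : SparsePoly StateMonomial) :
    Ideal.Quotient.mk K (p.ev stateChar) =
      p.ev fun m => Ideal.Quotient.mk K (stateChar m) := by
  simp [SparsePoly.ev, map_list_sum, List.map_map, Function.comp_def]

namespace StateMonomial

/-- The variable `F`. -/
def varF : SparsePoly StateMonomial := ⟨[(⟨1, 0, 0, 0, 0, 0, 0⟩, 1)]⟩
/-- The product `M X`. -/
def varX : SparsePoly StateMonomial := ⟨[(⟨0, 1, 0, 0, 0, 0, 0⟩, 1)]⟩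
/-- The product `M Y`. -/
def varY : SparsePoly StateMonomial := ⟨[(⟨0, 0, 1, 0, 0, 0, 0⟩, 1)]⟩
/-- The product `M A`. -/
def varA : SparsePoly StateMonomial := ⟨[(⟨0, 0, 0, 1, 0, 0, 0⟩, 1)]⟩
/-- The product `M B`. -/
def varB : SparsePoly StateMonomial := ⟨[(⟨0, 0, 0, 0, 1, 0, 0⟩, 1)]⟩
/-- The variable `Z`. -/
def varZ : SparsePoly StateMonomial := ⟨[(⟨0, 0, 0, 0, 0, 1, 0⟩, 1)]⟩
/-- The variable `o`. -/
def varO : SparsePoly StateMonomial := ⟨[(⟨0, 0, 0, 0, 0, 0, 1⟩, 1)]⟩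

/-- The coefficients of the crossings as sparse polynomials. -/
def crossingWeight : CrossingType → Smoothing → SparsePoly StateMonomial
  | .X1, .abcd => varA
  | .X1, .adbc => varB
  | .X1, .virt => varF
  | .X2, .abcd => varX
  | .X2, .adbc => varY
  | .X2, .virt => varZ

/-- The state sum of a diagram modulo `M ^ 3`, or `none` if the computation does not succeed. -/
def stateSumMod (D : Diagram) : Option (SparsePoly StateMonomial) :=
  match D.fits with
  | true => contract crossingWeight varO D
  | false => none

theorem mk_stateSum {K : Ideal (MvPolynomial (Fin 8) ℚ)} (hK : X 6 ^ 3 ∈ K) {D : Diagram}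
    {p : SparsePoly StateMonomial} (h : stateSumMod D = some p) :
    Ideal.Quotient.mk K (toRat D.stateSum) = p.ev fun m => Ideal.Quotient.mk K (stateChar m) := by
  unfold stateSumMod at h
  split at h
  · rename_i hD
    set φ : Ring8 →+* _ := (Ideal.Quotient.mk K).comp toRat
    change φ D.stateSum = _
    rw [stateSum_eq_weightedSum, map_weightedSum]
    refine contract_spec (isChar_stateChar hK) ?_ (fun t s => ?_) (fits_of_all hD) h
    · simp [varO, SparsePoly.ev, stateChar, φ, toRat]
    · cases t <;> cases s <;> simp [crossingWeight, varA, varB, varF, varX, varY, varZ,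
        SparsePoly.ev, stateChar, φ, toRat, weight]
  · cases h

/-! ### The ideal quotient of `𝓘_2` by `o` -/

/-- The ideal of the polynomials `p` with `o * p ∈ 𝓘_2`. -/
noncomputable def idealColon : Ideal (MvPolynomial (Fin 8) ℚ) :=
  Submodule.comap (LinearMap.mulLeft (MvPolynomial (Fin 8) ℚ) (X 7)) (idealAt 2)

theorem mem_idealColon {p : MvPolynomial (Fin 8) ℚ} :
    p ∈ idealColon ↔ X 7 * p ∈ idealAt 2 := Iff.rfl

theorem pow_mem_idealAt (k : ℕ) : X 6 ^ (k + 1) ∈ idealAt k :=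
  Ideal.mem_sup_right (Ideal.mem_span_singleton_self _)

/-- The value of a monomial modulo the ideal quotient. -/
noncomputable def colonChar (m : StateMonomial) : MvPolynomial (Fin 8) ℚ ⧸ idealColon :=
  Ideal.Quotient.mk idealColon (stateChar m)

theorem isChar_colonChar : SparsePoly.IsChar colonChar :=
  isChar_stateChar (mem_idealColon.mpr ((idealAt 2).mul_mem_left _ (pow_mem_idealAt 2)))

/-- The quotient of a polynomial by `o`, if it is divisible by `o`. -/
def divO (p : SparsePoly StateMonomial) : Option (SparsePoly StateMonomial) :=
  let q : SparsePoly StateMonomial := ⟨p.1.map fun t => ({ t.1 with o := t.1.o - 1 }, t.2)⟩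
  match (p - varO * q).isZero with
  | true => some q
  | false => none

/-- If `p = o * q` modulo `M ^ 3`, then `p` lies in `𝓘_2` exactly if `q` lies in the ideal
quotient. -/
theorem ev_divO {p q : SparsePoly StateMonomial} (h : divO p = some q) :
    p.ev stateChar ∈ idealAt 2 ↔ q.ev colonChar = 0 := by
  unfold divO at h
  simp only at h
  split at h
  · rename_i h0
    cases h
    rw [← Ideal.Quotient.eq_zero_iff_mem, mk_ev_stateChar, SparsePoly.ev_eq h0,
      SparsePoly.ev_mul (isChar_stateChar (pow_mem_idealAt 2)), ← mk_ev_stateChar,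
      ← mk_ev_stateChar, ← map_mul, Ideal.Quotient.eq_zero_iff_mem]
    have : varO.ev stateChar = X 7 := by simp [varO, SparsePoly.ev, stateChar]
    rw [this, ← mem_idealColon, ← Ideal.Quotient.eq_zero_iff_mem, mk_ev_stateChar]
    rfl
  · cases h

/-- The difference of the state sums of two diagrams, divided by `o`; it is `0` if the computation
does not succeed. -/
def reducedDifference (D D' : Diagram) : SparsePoly StateMonomial :=
  match stateSumMod D, stateSumMod D' with
  | some p, some q => (divO (p - q)).getD 0
  | _, _ => 0

/-- The relations of the local moves, divided by `o`. -/
def reducedRelations : List (SparsePoly StateMonomial) :=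
  moves.flatMap fun m => m.exteriors.map fun e =>
    reducedDifference (m.left.close e) (m.right.close e)

theorem ev_zero : (0 : SparsePoly StateMonomial).ev colonChar = 0 := by
  simpa using SparsePoly.ev_ofNat isChar_colonChar 0

/-- A relation by its index: `0, 1, 2` and `3, 4, 5` belong to the two moves of type 2, and
`6, …, 20` and `21, …, 35` to those of type 3. -/
def relation (i : ℕ) : SparsePoly StateMonomial := reducedRelations.getD i 0

theorem ev_relation (i : ℕ) : (relation i).ev colonChar = 0 := by
  have h : ∀ p ∈ reducedRelations, p.ev colonChar = 0 := by
    intro p hp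
    obtain ⟨m, hm, hp⟩ := List.mem_flatMap.mp hp
    obtain ⟨e, he, rfl⟩ := List.mem_map.mp hp
    unfold reducedDifference
    split
    · rename_i p q hp hq
      cases h : divO (p - q) with
      | none => exact ev_zero
      | some r =>
        refine (ev_divO h).mp ?_
        have h3 := pow_mem_idealAt 2
        rw [← Ideal.Quotient.eq_zero_iff_mem, mk_ev_stateChar, SparsePoly.ev_sub,
          ← mk_stateSum h3 hp, ← mk_stateSum h3 hq, ← map_sub, ← map_sub,
          Ideal.Quotient.eq_zero_iff_mem]
        exact Ideal.mem_sup_left (Ideal.subset_span ⟨_, ⟨m, hm, e, he, rfl⟩, rfl⟩)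
    · exact ev_zero
  unfold relation
  rw [List.getD_eq_getElem?_getD]
  cases hi : reducedRelations[i]? with
  | none => exact ev_zero
  | some p => exact h p (List.mem_of_getElem? hi)

/-! ### Consequences of the relations -/

/-- The value of `F` modulo the ideal quotient. -/
def valueF : SparsePoly StateMonomial :=
  varX + varO * varY - varA - varO * varB + varZ +
    (varO - 1) * varZ * (varA ^ 2 - 2 * varA * varB - (varO + 1) * varB ^ 2)

/-- The value of `Z ^ 2` modulo the ideal quotient. -/
def valueZZ : SparsePoly StateMonomial :=
  1 + varZ ^ 2 - (varX + varO * varY + varZ) * valueF - varA * (varX + varY + varO * varZ) -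
    varB * (varO * varX + varY + varZ)

/-- A relation of a move of type 3 has the leading part `F * Z * (F - Z)`, which becomes linear by the
relations of the moves of type 2, where `F * Z` has the constant term `1`. -/
theorem ev_varF : varF.ev colonChar = valueF.ev colonChar := by
  have h : ((varF - valueF) - (relation 33 + (varA + varO * varB - varF) * relation 3 +
      (varX + varO * varY - 2 * varA) * relation 4 - 2 * varB * relation 5 +
      varZ * relation 0)).isZero = true := by decide +kernel
  have h1 := SparsePoly.ev_eq (χ := colonChar) h
  simpa [SparsePoly.ev_add, SparsePoly.ev_sub, SparsePoly.ev_mul isChar_colonChar, ev_relation,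
    sub_eq_zero] using h1

/-- A relation `F * Z = 1 + …` of a move of type 2 becomes one for `Z ^ 2` once `F` is replaced. -/
theorem ev_varZZ : (varZ ^ 2).ev colonChar = valueZZ.ev colonChar := by
  have h : ((varZ ^ 2 - valueZZ) - (relation 4 -
      (varX + varO * varY + varZ) * (varF - valueF))).isZero = true := by decide +kernel
  have h1 := SparsePoly.ev_eq (χ := colonChar) h
  rw [SparsePoly.ev_sub, SparsePoly.ev_sub, SparsePoly.ev_mul isChar_colonChar,
    SparsePoly.ev_sub, ev_relation, ev_varF] at h1
  simpa [sub_eq_zero] using h1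

/-- Division of a monomial by `F`, if possible. -/
def divF (m : StateMonomial) : Option StateMonomial :=
  match m.f with
  | 0 => none
  | n + 1 => some { m with f := n }

/-- Division of a monomial by `Z ^ 2`, if possible. -/
def divZZ (m : StateMonomial) : Option StateMonomial :=
  match m.z with
  | n + 2 => some { m with z := n }
  | _ => none

/-- Eliminates `F` and `Z ^ 2`. The new powers of `Z` that a replacement of `Z ^ 2` produces come
with a factor `M`, so that three replacements suffice modulo `M ^ 3`. The bound `50` exceeds all
exponents that occur. -/
def eliminate (p : SparsePoly StateMonomial) : SparsePoly StateMonomial :=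
  let r := SparsePoly.replace divZZ valueZZ 50
  r (r (r (SparsePoly.replace divF valueF 50 p)))

theorem ev_eliminate (p : SparsePoly StateMonomial) :
    (eliminate p).ev colonChar = p.ev colonChar := by
  have hF : ∀ a b, divF a = some b → colonChar a = valueF.ev colonChar * colonChar b := by
    intro a b h
    have hv : varF.ev colonChar = Ideal.Quotient.mk idealColon (X 2) := by
      simp [varF, SparsePoly.ev, colonChar, stateChar]
    rw [← ev_varF, hv]
    unfold divF at h
    split at h
    · cases h
    · cases h
      rw [colonChar, colonChar, stateChar_f ‹_›, map_mul]
  have hZ : ∀ a b, divZZ a = some b → colonChar a = valueZZ.ev colonChar * colonChar b := by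
    intro a b h
    have hv : varZ.ev colonChar = Ideal.Quotient.mk idealColon (X 5) := by
      simp [varZ, SparsePoly.ev, colonChar, stateChar]
    rw [← ev_varZZ, SparsePoly.ev_pow isChar_colonChar, hv]
    unfold divZZ at h
    split at h
    · cases h
      rw [colonChar, colonChar, stateChar_z ‹_›, map_mul, map_pow]
    · cases h
  simp only [eliminate, SparsePoly.ev_replace isChar_colonChar hZ,
    SparsePoly.ev_replace isChar_colonChar hF]

theorem ev_eq_of_eliminate {p q : SparsePoly StateMonomial}
    (h : (eliminate (p - q)).isZero = true) : p.ev colonChar = q.ev colonChar := by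
  rw [← sub_eq_zero, ← SparsePoly.ev_sub, ← ev_eliminate, SparsePoly.ev_eq_zero h]

/-- Positive integers are units, since the coefficients are rational. -/
theorem ev_eq_zero_of_mul {c : ℕ} [NeZero c] {p : SparsePoly StateMonomial}
    (h : ((SparsePoly.const c) * p).ev colonChar = 0) : p.ev colonChar = 0 := by
  rw [SparsePoly.ev_mul isChar_colonChar, SparsePoly.ev_const isChar_colonChar] at h
  have hc := (isUnit_iff_ne_zero.mpr (NeZero.ne (c : ℚ))).map
    (algebraMap ℚ (MvPolynomial (Fin 8) ℚ ⧸ idealColon))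
  rw [map_natCast] at hc
  rw [Int.cast_natCast] at h
  exact hc.mul_right_eq_zero.mp h

-- The multipliers in the following proofs solve linear systems over `ℚ` whose unknowns are their
-- coefficients; denominators are cleared.

theorem ev_relation_one :
    ((varO - 1) * (varX - varY - varA + varB)).ev colonChar = 0 := by
  refine ev_eq_zero_of_mul (c := 2) ?_
  rw [ev_eq_of_eliminate (q :=
    2 * (varX + varO * varY - 2 * varA - varO * varB + varZ) * relation 1 +
    2 * (varY - varX + varA - varB) * relation 2 +
    varZ * (varX - varY) * relation 16) (by decide +kernel)]
  simp [SparsePoly.ev_add, SparsePoly.ev_mul isChar_colonChar, ev_relation]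

theorem ev_relation_two :
    ((varO - 1) * (varO + 2) * (varY - varB)).ev colonChar = 0 := by
  refine ev_eq_zero_of_mul (c := 4) ?_
  rw [ev_eq_of_eliminate (q :=
    2 * varZ * varO * relation 0 +
    (4 * varY - 2 * varX - 2 * varO * varY + 4 * varA + 4 * varO * varB - 2 * varB - 4 * varZ) *
      relation 1 +
    (2 * varX - 2 * varO * varY - 4 * varY - 2 * varA + 4 * varO * varB + 4 * varB) * relation 2 +
    4 * relation 12 + (varZ * (varY - varX) - 2) * relation 16) (by decide +kernel)]
  simp [SparsePoly.ev_add, SparsePoly.ev_mul isChar_colonChar, ev_relation]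

theorem ev_relation_three :
    ((varO - 1) * (varO + 2) * (varA + varB)).ev colonChar = 0 := by
  refine ev_eq_zero_of_mul (c := 4) ?_
  rw [ev_eq_of_eliminate (q :=
    (-2) * varZ * (varO + 2) * relation 0 +
    (4 * varA + 2 * varB - 6 * varX - 6 * varO * varY - 8 * varY) * relation 1 +
    (2 * varA - 4 * varO * varA - 6 * varX - 6 * varO * varY - 4 * varB - 4 * varZ) * relation 2 +
    (-4) * relation 12 +
    (varZ * (3 * varY + 2 * varO * varY - varX) + 2) * relation 16) (by decide +kernel)]
  simp [SparsePoly.ev_add, SparsePoly.ev_mul isChar_colonChar, ev_relation]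

theorem ev_relation_four :
    ((varO - 1) * (varA ^ 2 + varO * varA * varB + varB ^ 2)).ev colonChar = 0 := by
  refine ev_eq_zero_of_mul (c := 2) ?_
  rw [ev_eq_of_eliminate (q :=
    2 * relation 0 + 2 * varB * varZ * relation 1 + varA * relation 16) (by decide +kernel)]
  simp [SparsePoly.ev_add, SparsePoly.ev_mul isChar_colonChar, ev_relation]

theorem ev_relation_five :
    ((varO - 1) * (varO ^ 2 - 4) * varB ^ 2).ev colonChar = 0 := by
  refine ev_eq_zero_of_mul (c := 2) ?_
  rw [ev_eq_of_eliminate (q :=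
    (-4) * relation 0 + (-2) * varZ * (varA + 3 * varB) * relation 1 +
    2 * varZ * (varY - varA) * relation 2 + 2 * varZ * relation 12 +
    (-1) * (varY + 2 * varA + varB) * relation 16) (by decide +kernel)]
  simp [SparsePoly.ev_add, SparsePoly.ev_mul isChar_colonChar, ev_relation]

/-! ### The state sums of the two links modulo `𝓘_2` -/

/-- A combination of the five relations with the coefficients `c`. -/
def combination (c : Fin 5 → SparsePoly StateMonomial) : SparsePoly StateMonomial :=
  c 0 * ((varO - 1) * (varX - varY - varA + varB)) +
  c 1 * ((varO - 1) * (varO + 2) * (varY - varB)) +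
  c 2 * ((varO - 1) * (varO + 2) * (varA + varB)) +
  c 3 * ((varO - 1) * (varA ^ 2 + varO * varA * varB + varB ^ 2)) +
  c 4 * ((varO - 1) * (varO ^ 2 - 4) * varB ^ 2)

theorem ev_combination (c : Fin 5 → SparsePoly StateMonomial) :
    (combination c).ev colonChar = 0 := by
  unfold combination
  simp only [SparsePoly.ev_add, SparsePoly.ev_mul isChar_colonChar _ (_ * _), ev_relation_one,
    ev_relation_two, ev_relation_three, ev_relation_four, ev_relation_five, mul_zero, add_zero]

/-- The state sum of `D` and `o * p` differ by `o` times a combination of the five relations. -/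
def isReduction (D : Diagram) (p : SparsePoly StateMonomial)
    (c : Fin 5 → SparsePoly StateMonomial) : Bool :=
  match stateSumMod D with
  | some q => match divO (q - varO * p) with
    | some r => (eliminate (r - combination c)).isZero
    | none => false
  | none => false

theorem sub_mem_of_isReduction {D : Diagram} {p : SparsePoly StateMonomial}
    {c : Fin 5 → SparsePoly StateMonomial} (h : isReduction D p c = true) :
    toRat D.stateSum - X 7 * p.ev stateChar ∈ idealAt 2 := by
  unfold isReduction at h
  split at h
  · rename_i q hq
    split at h
    · rename_i r hr
      have h1 := (ev_divO hr).mpr ((ev_eq_of_eliminate h).trans (ev_combination c))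
      have h3 := pow_mem_idealAt 2
      rw [← Ideal.Quotient.eq_zero_iff_mem, mk_ev_stateChar, SparsePoly.ev_sub,
        SparsePoly.ev_mul (isChar_stateChar h3), ← mk_stateSum h3 hq, ← mk_ev_stateChar,
        ← mk_ev_stateChar, ← map_mul, ← map_sub, Ideal.Quotient.eq_zero_iff_mem] at h1
      have : varO.ev stateChar = X 7 := by simp [varO, SparsePoly.ev, stateChar]
      rwa [this] at h1
    · cases h
  · cases h

-- The coefficients in the following two reductions also come from linear systems.

theorem isReduction_JS14 : isReduction JS14
    (16 * (varZ ^ 2 - 1) * varO ^ 2 + (16 * varZ ^ 2 - 15) * varO - 32 * (varZ ^ 2 - 1))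
    ![varX * varO + 52 * varX + 41 * varY * varO ^ 2 + 10 * varY * varO - 184 * varY - 72 * varA +
        72 * varB + 35 * varZ * varO + 60 * varZ,
      116 * varX - 24 * varX * varO + 16 * varY * varO ^ 2 + 55 * varY * varO - 98 * varY +
        67 * varA * varO - 136 * varA + 46 * varB + 32 * varZ * varO + 28 * varZ,
      70 * varX - 18 * varX * varO + 3 * varY * varO + 6 * varY + 37 * varA * varO - 32 * varA +
        16 * varZ * varO + 12 * varZ,
      -20 * varO - 52, -16 * varO - 32] = true := by
  decide +kernel

theorem isReduction_T15 : isReduction T15 varO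
    ![varX * varO ^ 2 - 11 * varX * varO + 12 * varX - varY * varO ^ 2 - 23 * varY * varO -
        72 * varY - 44 * varA + 44 * varB + 2 * varZ * varO - 4 * varZ,
      44 * varX - 10 * varX * varO + 8 * varY * varO - 42 * varY + 27 * varA * varO - 71 * varA +
        15 * varB - 4 * varZ,
      32 * varX - 9 * varX * varO + 5 * varY * varO + 3 * varY + 15 * varA * varO - 23 * varA -
        4 * varZ,
      2 * varO - 10, -3] = true := by
  decide +kernel

end StateMonomial

end VSE

namespace VSE

/-! ### The values of the invariant -/

/-- The exponents of the monomials `Z ^ i * o ^ j` with `i ≤ 2` and `j ≤ 3`. -/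
def reducedExponents : Set (Fin 8 →₀ ℕ) :=
  {c | (∀ x : Fin 8, x < 5 → c x = 0) ∧ c 5 ≤ 2 ∧ c 6 = 0 ∧ c 7 ≤ 3}

theorem mul_mem_restrictSupport {i j : ℕ} (hi : i ≤ 2) (hj : j ≤ 3) :
    (X 5 ^ i * X 7 ^ j : MvPolynomial (Fin 8) ℚ) ∈ restrictSupport ℚ reducedExponents := by
  rw [X_pow_eq_monomial, X_pow_eq_monomial, monomial_mul, mem_restrictSupport_iff]
  intro c hc
  obtain rfl := Finset.mem_singleton.mp (support_monomial_subset hc)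
  refine ⟨fun x hx => ?_, by simpa using hi, by simp, by simpa using hj⟩
  have h1 : (5 : Fin 8) ≠ x := by rintro rfl; exact absurd hx (by decide)
  have h2 : (7 : Fin 8) ≠ x := by rintro rfl; exact absurd hx (by decide)
  simp [h1, h2]

theorem eta_two_eq_of_isReduction {D : Diagram} {p : SparsePoly StateMonomial}
    {c : Fin 5 → SparsePoly StateMonomial} (h : StateMonomial.isReduction D p c = true)
    {r : MvPolynomial (Fin 8) ℚ}
    (hr : Ideal.Quotient.mk (idealAt 2) r =
      p.ev fun m => Ideal.Quotient.mk (idealAt 2) (stateChar m))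
    (hs : X 7 * r ∈ restrictSupport ℚ reducedExponents) : eta 2 D = X 7 * r := by
  refine eta_two_eq ?_ hs
  rw [← Ideal.Quotient.eq_zero_iff_mem, map_sub, map_mul, hr, ← mk_ev_stateChar, ← map_mul,
    ← map_sub, Ideal.Quotient.eq_zero_iff_mem]
  exact StateMonomial.sub_mem_of_isReduction h

theorem ev_varO (K : Ideal (MvPolynomial (Fin 8) ℚ)) :
    StateMonomial.varO.ev (fun m => Ideal.Quotient.mk K (stateChar m)) =
      Ideal.Quotient.mk K (X 7) := by
  simp [StateMonomial.varO, SparsePoly.ev, stateChar]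

theorem ev_varZ (K : Ideal (MvPolynomial (Fin 8) ℚ)) :
    StateMonomial.varZ.ev (fun m => Ideal.Quotient.mk K (stateChar m)) =
      Ideal.Quotient.mk K (X 5) := by
  simp [StateMonomial.varZ, SparsePoly.ev, stateChar]

theorem eta_two_JS14 : eta 2 JS14 =
    X 7 * (16 * (X 5 ^ 2 - 1) * X 7 ^ 2 + (16 * X 5 ^ 2 - 15) * X 7 - 32 * (X 5 ^ 2 - 1)) := by
  refine eta_two_eq_of_isReduction StateMonomial.isReduction_JS14 ?_ ?_
  · have hχ := isChar_stateChar (StateMonomial.pow_mem_idealAt 2)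
    simp only [SparsePoly.ev_add, SparsePoly.ev_sub, SparsePoly.ev_mul hχ, SparsePoly.ev_pow hχ,
      SparsePoly.ev_ofNat hχ, ev_varO, ev_varZ, map_add, map_sub, map_mul,
      map_pow, map_ofNat, map_one, Nat.cast_ofNat, Nat.cast_one]
  · have h : (X 7 * (16 * (X 5 ^ 2 - 1) * X 7 ^ 2 + (16 * X 5 ^ 2 - 15) * X 7 -
        32 * (X 5 ^ 2 - 1)) : MvPolynomial (Fin 8) ℚ) =
        (16 : ℚ) • (X 5 ^ 2 * X 7 ^ 3) - (16 : ℚ) • (X 5 ^ 0 * X 7 ^ 3) +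
        (16 : ℚ) • (X 5 ^ 2 * X 7 ^ 2) - (15 : ℚ) • (X 5 ^ 0 * X 7 ^ 2) -
        (32 : ℚ) • (X 5 ^ 2 * X 7 ^ 1) + (32 : ℚ) • (X 5 ^ 0 * X 7 ^ 1) := by
      simp only [smul_eq_C_mul, map_ofNat]; ring
    rw [h]
    refine add_mem (sub_mem (sub_mem (add_mem (sub_mem ?_ ?_) ?_) ?_) ?_) ?_ <;>
      exact Submodule.smul_mem _ _ (mul_mem_restrictSupport (by norm_num) (by norm_num))

theorem pow_mem_restrictSupport : (X 7 ^ 2 : MvPolynomial (Fin 8) ℚ) ∈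
    restrictSupport ℚ reducedExponents := by
  simpa using mul_mem_restrictSupport (i := 0) (j := 2) (by norm_num) (by norm_num)

theorem eta_two_T15 : eta 2 T15 = X 7 ^ 2 := by
  rw [pow_two]
  refine eta_two_eq_of_isReduction StateMonomial.isReduction_T15 (ev_varO _).symm ?_
  rw [← pow_two]
  exact pow_mem_restrictSupport

theorem stateSum_unlink2 : unlink2.stateSum = X 7 ^ 2 := by
  rw [stateSum_eq_weightedSum, unlink2, weightedSum_nil]
  simp [loops]

theorem eta_two_unlink2 : eta 2 unlink2 = X 7 ^ 2 := by
  refine eta_two_eq ?_ pow_mem_restrictSupport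
  rw [stateSum_unlink2]
  simp [toRat]

theorem eta_two_JS14_ne : eta 2 JS14 ≠ X 7 ^ 2 := by
  rw [eta_two_JS14]
  intro h
  have := congrArg (eval fun i : Fin 8 => if i = 7 then 2 else 0) h
  -- at `Z = 0` and `o = 2`, the left-hand side is `-124`
  have h57 : (5 : Fin 8) ≠ 7 := by decide
  norm_num [h57] at this

/-- The specializations are functions of the full invariant, because `𝓘_∞ ≤ 𝓘_k`. -/
theorem eta_eq_of_etaInf_eq (k : ℕ) {D D' : Diagram} (h : etaInf D = etaInf D') :
    eta k D = eta k D' := by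
  refine isNormalForm_unique (idealAt k) _ _ _ (normalForm_spec _ _) ?_
  have h1 := normalForm_spec (idealAt k) (toRat D'.stateSum)
  refine ⟨?_, h1.2⟩
  have h2 : toRat D.stateSum - toRat D'.stateSum ∈ idealAt k :=
    Ideal.mem_sup_left (sub_mem_of_normalForm_eq h)
  have h3 := (idealAt k).add_mem h2 h1.1
  rwa [sub_add_sub_cancel] at h3

/-! ### The states that do not vanish modulo a power of `M` -/

/-- The number of smoothings of a state that are not virtual; each has a coefficient with the
factor `M`. -/
def realCount {n : ℕ} (s : Fin n → Smoothing) : ℕ := (Finset.univ.filter fun i => s i ≠ .virt).card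

/-- The generating function of the states by the number of real smoothings is `(1 + 2 * t) ^ n`. -/
theorem card_realCount_eq (n k : ℕ) :
    (Finset.univ.filter fun s : Fin n → Smoothing => realCount s = k).card =
      n.choose k * 2 ^ k := by
  have h : (∑ s : Fin n → Smoothing, (Polynomial.X : Polynomial ℕ) ^ realCount s) =
      (2 * Polynomial.X + 1) ^ n := by
    have h1 : ∀ s : Fin n → Smoothing, (Polynomial.X : Polynomial ℕ) ^ realCount s =
        ∏ i, if s i ≠ .virt then Polynomial.X else 1 := fun s => by
      rw [Finset.prod_ite, Finset.prod_const, Finset.prod_const_one, mul_one]; rfl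
    have h2 : ∑ x : Smoothing, (if x ≠ .virt then Polynomial.X else 1 : Polynomial ℕ) =
        2 * Polynomial.X + 1 := by
      rw [sum_smoothing]; simp; ring
    simp only [h1]
    rw [← Fintype.prod_sum fun (_ : Fin n) (x : Smoothing) =>
      (if x ≠ .virt then Polynomial.X else 1 : Polynomial ℕ)]
    simp only [h2, Finset.prod_const, Finset.card_univ, Fintype.card_fin]
  have h3 := congrArg (fun p => p.coeff k) h
  simp only [Polynomial.finsetSum_coeff, Polynomial.coeff_X_pow] at h3
  rw [Finset.card_filter]
  simp only [eq_comm (a := k)] at h3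
  rw [h3, add_pow]
  simp only [one_pow, mul_one, mul_pow]
  rw [Polynomial.finsetSum_coeff]
  have h4 : ∀ m, (2 ^ m * Polynomial.X ^ m * (n.choose m : Polynomial ℕ)).coeff k =
      if k = m then n.choose m * 2 ^ m else 0 := fun m => by
    rw [show (2 ^ m * Polynomial.X ^ m * (n.choose m : Polynomial ℕ)) =
      Polynomial.C (n.choose m * 2 ^ m) * Polynomial.X ^ m by
        rw [map_mul, map_pow, map_ofNat, ← Nat.cast_id (n.choose m), Polynomial.C_eq_natCast,
          Nat.cast_id]
        ring, Polynomial.coeff_C_mul,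
        Polynomial.coeff_X_pow]
    split_ifs <;> simp
  simp only [h4]
  rw [Finset.sum_ite_eq]
  split_ifs with hk
  · rfl
  · rw [Nat.choose_eq_zero_of_lt (by simpa using hk), zero_mul]

/-- The substitution of `1` for all variables except `M`. -/
noncomputable def onlyM : Ring8 →+* Polynomial ℤ :=
  eval₂Hom Polynomial.C fun i => if i = 6 then Polynomial.X else 1

theorem onlyM_stateTerm {D : Diagram} (s : D.State) :
    onlyM (D.stateTerm s) = Polynomial.X ^ realCount s := by
  have h1 : ∀ t x, onlyM (weight t x) = if x ≠ .virt then Polynomial.X else 1 := by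
    intro t x
    cases t <;> cases x <;> simp [onlyM, weight]
  rw [Diagram.stateTerm, map_mul, map_prod, map_pow]
  simp only [h1]
  rw [Finset.prod_ite, Finset.prod_const, Finset.prod_const_one, mul_one]
  simp [onlyM, realCount]

theorem pow_realCount_dvd {D : Diagram} (s : D.State) : X 6 ^ realCount s ∣ D.stateTerm s := by
  have h1 : ∀ t x, (if x ≠ Smoothing.virt then X 6 else 1 : Ring8) ∣ weight t x := by
    intro t x
    cases t <;> cases x <;> simp [weight]
  refine Dvd.dvd.mul_right ?_ _
  have h2 := Finset.prod_dvd_prod_of_dvd (s := Finset.univ) _ _ fun i _ =>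
    h1 (D.crossings.get i).type (s i)
  rwa [Finset.prod_ite, Finset.prod_const, Finset.prod_const_one, mul_one] at h2

theorem mem_nonNullStates {D : Diagram} {k : ℕ} {s : D.State} :
    s ∈ D.nonNullStates k ↔ realCount s ≤ k := by
  change D.stateTerm s ∉ Ideal.span {(X 6 ^ (k + 1) : Ring8)} ↔ _
  rw [Ideal.mem_span_singleton, ← not_lt, not_iff_not]
  constructor
  · intro h
    have h1 := map_dvd onlyM h
    rw [onlyM_stateTerm, map_pow] at h1
    have h2 : onlyM (X 6) = Polynomial.X := by simp [onlyM]
    rw [h2] at h1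
    exact (pow_dvd_pow_iff Polynomial.X_ne_zero Polynomial.not_isUnit_X).mp h1
  · exact fun h => (pow_dvd_pow _ h).trans (pow_realCount_dvd s)

theorem ncard_nonNullStates (D : Diagram) (k : ℕ) : (D.nonNullStates k).ncard =
    ∑ j ∈ Finset.range (k + 1), D.crossings.length.choose j * 2 ^ j := by
  have h1 : D.nonNullStates k =
      ((Finset.range (k + 1)).biUnion fun j =>
        Finset.univ.filter fun s : D.State => realCount s = j : Finset D.State) := by
    ext s
    simp [mem_nonNullStates]
  rw [h1, Set.ncard_coe_finset, Finset.card_biUnion]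
  · exact Finset.sum_congr rfl fun j _ => card_realCount_eq _ j
  · intro i _ j _ hij
    rw [Function.onFun, Finset.disjoint_filter]
    exact fun s _ h h' => hij (h.symm.trans h')

theorem ncard_nonNullStates_JS14 : (JS14.nonNullStates 2).ncard = 801 := by
  rw [ncard_nonNullStates]
  decide

end VSE

namespace VSE

/-! ### Counting faces and components -/

/-- The number of classes of a relation, from a function whose fibres are the classes. -/
theorem card_quot {α β : Type*} {r : α → α → Prop} (f : α → β) (hr : ∀ p q, r p q → f p = f q)
    (hf : Function.Surjective f) (hc : ∀ p q, f p = f q → Relation.EqvGen r p q) :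
    Nat.card (Quot r) = Nat.card β := by
  refine Nat.card_congr (Equiv.ofBijective (Quot.lift f hr) ⟨?_, fun b => ?_⟩)
  · rintro ⟨p⟩ ⟨q⟩ h
    exact Quot.eqvGen_sound (hc p q h)
  · obtain ⟨p, rfl⟩ := hf b
    exact ⟨Quot.mk r p, rfl⟩

theorem eqvGen_of_isChain {α : Type*} {r : α → α → Prop} {l : List α} (h : l.IsChain r) :
    ∀ p ∈ l, ∀ q ∈ l, Relation.EqvGen r p q := by
  induction l with
  | nil => simp
  | cons a l ih =>
    have hl := ih h.tail
    have ha : ∀ q ∈ l, Relation.EqvGen r a q := by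
      intro q hq
      cases l with
      | nil => cases hq
      | cons b l =>
        exact (Relation.EqvGen.rel _ _ (List.isChain_cons_cons.mp h).1).trans _ _ _
          (hl b List.mem_cons_self q hq)
    have ha' : ∀ q ∈ a :: l, Relation.EqvGen r a q := fun q hq =>
      (List.mem_cons.mp hq).elim (fun h => h ▸ .refl _) (ha q)
    exact fun p hp q hq => (ha' p hp).symm.trans _ _ _ (ha' q hq)

namespace Diagram

instance (D : Diagram) : DecidableRel D.Joined := fun _ _ => inferInstanceAs (Decidable (_ ∧ _))

instance (D : Diagram) : DecidableRel D.FaceAdj :=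
  fun _ _ => inferInstanceAs (Decidable (D.Joined _ _))

instance (D : Diagram) : DecidablePred D.Shaded := fun _ => inferInstanceAs (Decidable (_ ↔ _))

/-- The list `faces` contains every face of the diagram once, as a list of consecutive corners. A
face is identified by its position in the list, which is constant along adjacent corners. -/
structure IsFaceList (D : Diagram) (faces : List (List D.End)) : Prop where
  isChain : ∀ l ∈ faces, l.IsChain D.FaceAdj
  exists_mem : ∀ p, ∃ l ∈ faces, p ∈ l
  adj : ∀ p q, D.FaceAdj p q →
    faces.findIdx (fun l => decide (p ∈ l)) = faces.findIdx fun l => decide (q ∈ l)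
  surjective : ∀ i : Fin faces.length, ∃ p, faces.findIdx (fun l => decide (p ∈ l)) = i

theorem isFaceList_iff {D : Diagram} {faces : List (List D.End)} : D.IsFaceList faces ↔
    (∀ l ∈ faces, l.IsChain D.FaceAdj) ∧ (∀ p, ∃ l ∈ faces, p ∈ l) ∧
    (∀ p q, D.FaceAdj p q →
      faces.findIdx (fun l => decide (p ∈ l)) = faces.findIdx fun l => decide (q ∈ l)) ∧
    ∀ i : Fin faces.length, ∃ p, faces.findIdx (fun l => decide (p ∈ l)) = i :=
  ⟨fun h => ⟨h.1, h.2, h.3, h.4⟩, fun h => ⟨h.1, h.2.1, h.2.2.1, h.2.2.2⟩⟩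

instance (D : Diagram) (faces : List (List D.End)) : Decidable (D.IsFaceList faces) :=
  decidable_of_iff' _ isFaceList_iff

theorem card_faces {D : Diagram} {faces : List (List D.End)} (h : D.IsFaceList faces) :
    Nat.card (Quot D.FaceAdj) = faces.length := by
  have hlt : ∀ p, faces.findIdx (fun l => decide (p ∈ l)) < faces.length := fun p => by
    obtain ⟨l, hl, hp⟩ := h.exists_mem p
    exact List.findIdx_lt_length_of_exists ⟨l, hl, by simpa using hp⟩
  rw [card_quot (β := Fin faces.length) (fun p => ⟨_, hlt p⟩), Nat.card_fin]
  · exact fun p q hpq => Fin.ext (h.adj p q hpq)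
  · intro i
    obtain ⟨p, hp⟩ := h.surjective i
    exact ⟨p, Fin.ext hp⟩
  · intro p q hpq
    have hp := List.findIdx_getElem (w := hlt p)
    have hq := List.findIdx_getElem (w := hlt q)
    simp only [Fin.mk.injEq] at hpq
    simp only [decide_eq_true_eq] at hp hq
    simp only [← hpq] at hq
    exact eqvGen_of_isChain (h.isChain _ (List.getElem_mem _)) p hp q hq

/-- The diagram is connected and consists of two strands, whose edges are numbered consecutively by
`1, …, m` and by `m + 1, m + 2, …`. -/
structure IsNumbered (D : Diagram) (m : ℕ) : Prop where
  pos : 1 ≤ m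
  across : ∀ p : D.End, D.label (p.1, p.2 + 2) ≤ m ↔ D.label p ≤ m
  /-- every edge except for the first edges of the strands continues the preceding edge -/
  prev : ∀ p : D.End, D.label p = 1 ∨ D.label p = m + 1 ∨
    ∃ q : D.End, D.label (q.1, q.2 + 2) = D.label p ∧ D.label q + 1 = D.label p
  /-- some crossing belongs to both strands -/
  common : ∃ i s t, D.label (i, s) ≤ m ∧ ¬ D.label (i, t) ≤ m

theorem isNumbered_iff {D : Diagram} {m : ℕ} : D.IsNumbered m ↔
    1 ≤ m ∧ (∀ p : D.End, D.label (p.1, p.2 + 2) ≤ m ↔ D.label p ≤ m) ∧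
    (∀ p : D.End, D.label p = 1 ∨ D.label p = m + 1 ∨
      ∃ q : D.End, D.label (q.1, q.2 + 2) = D.label p ∧ D.label q + 1 = D.label p) ∧
    ∃ i s t, D.label (i, s) ≤ m ∧ ¬ D.label (i, t) ≤ m :=
  ⟨fun h => ⟨h.1, h.2, h.3, h.4⟩, fun h => ⟨h.1, h.2.1, h.2.2.1, h.2.2.2⟩⟩

instance (D : Diagram) (m : ℕ) : Decidable (D.IsNumbered m) :=
  decidable_of_iff' _ isNumbered_iff

namespace IsNumbered

variable {D : Diagram} {m : ℕ}

theorem eqvGen_of_label_eq {p q : D.End} (h : D.label p = D.label q) :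
    Relation.EqvGen D.StrandAdj p q := by
  by_cases hpq : p = q
  · rw [hpq]
    exact .refl _
  · exact .rel _ _ (Or.inl ⟨hpq, h⟩)

/-- Every edge end is connected with the first edge of its strand. -/
theorem eqvGen_first (h : D.IsNumbered m) : ∀ n, ∀ p : D.End, D.label p = n →
    ∃ q : D.End, D.label q = (if n ≤ m then 1 else m + 1) ∧ Relation.EqvGen D.StrandAdj p q := by
  intro n
  induction n with
  | zero =>
    intro p hp
    rcases h.prev p with h1 | h1 | ⟨q, -, h1⟩ <;> omega
  | succ n ih =>
    intro p hp
    by_cases h1 : D.label p = 1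
    · refine ⟨p, ?_, .refl _⟩
      rw [if_pos (by have := h.pos; omega), h1]
    by_cases h2 : D.label p = m + 1
    · refine ⟨p, ?_, .refl _⟩
      rw [if_neg (by omega), h2]
    obtain ⟨q, hq1, hq2⟩ := ((h.prev p).resolve_left h1).resolve_left h2
    obtain ⟨q', hq', hc⟩ := ih q (by omega)
    refine ⟨q', ?_, ((eqvGen_of_label_eq hq1.symm).trans _ _ _
      ((Relation.EqvGen.rel q _ (Or.inr rfl)).symm)).trans _ _ _ hc⟩
    rw [hq']
    split_ifs <;> omega

theorem eqvGen_of_iff (h : D.IsNumbered m) {p q : D.End} (hpq : D.label p ≤ m ↔ D.label q ≤ m) :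
    Relation.EqvGen D.StrandAdj p q := by
  obtain ⟨p', hp', hp⟩ := h.eqvGen_first _ p rfl
  obtain ⟨q', hq', hq⟩ := h.eqvGen_first _ q rfl
  refine (hp.trans _ _ _ (eqvGen_of_label_eq ?_)).trans _ _ _ hq.symm
  rw [hp', hq']
  simp only [hpq]

theorem card_strands (h : D.IsNumbered m) : Nat.card (Quot D.StrandAdj) = 2 := by
  rw [card_quot (β := Bool) (fun p => decide (D.label p ≤ m)), Nat.card_eq_fintype_card,
    Fintype.card_bool]
  · rintro p q (⟨-, hpq⟩ | rfl)
    · simp only [hpq]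
    · exact decide_eq_decide.mpr (h.across p).symm
  · obtain ⟨i, s, t, hs, ht⟩ := h.common
    rintro (_ | _)
    · exact ⟨(i, t), by simpa using ht⟩
    · exact ⟨(i, s), by simpa using hs⟩
  · exact fun p q hpq => h.eqvGen_of_iff (decide_eq_decide.mp hpq)

theorem eqvGen_crossing {p q : D.End} (h : Relation.EqvGen D.StrandAdj p q) :
    Relation.EqvGen D.CrossingAdj p.1 q.1 := by
  induction h with
  | rel p q hpq =>
    rcases hpq with ⟨-, hpq⟩ | rfl
    · exact .rel _ _ ⟨p.2, q.2, hpq⟩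
    · exact .refl _
  | refl => exact .refl _
  | symm _ _ _ ih => exact ih.symm
  | trans _ _ _ _ _ ih1 ih2 => exact ih1.trans _ _ _ ih2

/-- The diagram is connected, because both strands are and they meet. -/
theorem card_crossings (h : D.IsNumbered m) : Nat.card (Quot D.CrossingAdj) = 1 := by
  obtain ⟨i, s, t, hs, ht⟩ := h.common
  rw [card_quot (β := Unit) (fun _ => ()) (fun _ _ _ => rfl) (fun _ => ⟨i, rfl⟩),
    Nat.card_unique]
  have hi : ∀ j, Relation.EqvGen D.CrossingAdj j i := by
    intro j
    by_cases hj : D.label (j, 0) ≤ m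
    · exact eqvGen_crossing (h.eqvGen_of_iff (p := (j, 0)) (q := (i, s)) (by simp [hj, hs]))
    · exact eqvGen_crossing (h.eqvGen_of_iff (p := (j, 0)) (q := (i, t)) (by simp [hj, ht]))
  exact fun j k _ => (hi j).trans _ _ _ (hi k).symm

end IsNumbered

/-- A connected diagram of two strands is planar if there are two more faces than crossings. -/
theorem isLinkDiagram_of_isNumbered {D : Diagram} {m : ℕ} (h : D.IsNumbered m) (ha : D.arcs = [])
    {faces : List (List D.End)} (hf : D.IsFaceList faces)
    (hn : faces.length = D.crossings.length + 2)
    (hc : ∀ x ∈ D.crossings.flatMap fun y => [y.a, y.b, y.c, y.d],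
      (D.crossings.flatMap fun y => [y.a, y.b, y.c, y.d]).count x = 2)
    (hs : ∀ p q, D.FaceAdj p q → (D.Shaded p ↔ D.Shaded q)) :
    D.IsLinkDiagram ∧ D.components = 2 := by
  refine ⟨⟨?_, ?_, ?_, hs⟩, ?_⟩
  · simpa only [ha, List.flatMap_nil, List.append_nil] using hc
  · simp [ha]
  · rw [card_faces hf, h.card_crossings, hn]
  · rw [components, h.card_strands, ha, List.length_nil]

end Diagram

/-- The faces of `JS14`. -/
def facesJS14 : List (List JS14.End) :=
  ([[(0, 0), (9, 0)], [(0, 1), (10, 1), (13, 1), (8, 1), (9, 3)], [(0, 2), (1, 1), (10, 0)],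
    [(0, 3), (9, 1), (8, 3), (7, 1), (7, 3), (6, 1), (6, 3), (5, 1), (5, 3), (4, 2), (14, 2),
      (15, 0), (16, 2), (17, 2), (17, 0), (18, 2), (18, 0), (19, 2), (19, 0), (1, 0)],
    [(1, 2), (2, 1), (11, 0), (10, 3)], [(1, 3), (19, 1), (18, 1), (17, 1), (16, 3), (2, 0)],
    [(2, 2), (3, 0), (12, 3), (11, 3)], [(2, 3), (16, 0), (15, 2), (14, 0), (3, 3)],
    [(3, 1), (4, 0), (13, 3), (12, 2)], [(3, 2), (14, 1), (4, 3)],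
    [(4, 1), (5, 0), (6, 0), (7, 0), (8, 0), (13, 2)], [(5, 2)], [(6, 2)], [(7, 2)],
    [(8, 2), (9, 2)], [(10, 2), (11, 1), (12, 1), (13, 0)], [(11, 2), (12, 0)],
    [(14, 3), (15, 3)], [(15, 1), (16, 1)], [(17, 3)], [(18, 3)], [(19, 3)]] :
    List (List (Fin 20 × Fin 4)))

/-- The faces of `T15`. -/
def facesT15 : List (List T15.End) :=
  ([[(0, 0), (8, 3), (13, 1), (12, 3), (11, 1), (11, 3), (10, 1), (10, 3), (9, 1), (9, 3), (3, 2),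
      (14, 2), (15, 0), (17, 2)],
    [(0, 1), (4, 0), (8, 2)], [(0, 2), (1, 1), (5, 0), (4, 3)],
    [(0, 3), (17, 3), (16, 3), (1, 0)], [(1, 2), (2, 0), (6, 3), (5, 3)],
    [(1, 3), (16, 0), (15, 2), (14, 0), (2, 3)], [(2, 1), (3, 0), (7, 3), (6, 2)],
    [(2, 2), (14, 1), (3, 3)], [(3, 1), (9, 0), (10, 0), (11, 0), (12, 0), (7, 2)],
    [(4, 1), (7, 1), (12, 1), (13, 3), (8, 1)], [(4, 2), (5, 1), (6, 1), (7, 0)],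
    [(5, 2), (6, 0)], [(8, 0), (13, 0)], [(9, 2)], [(10, 2)], [(11, 2)], [(12, 2), (13, 2)],
    [(14, 3), (15, 3)], [(15, 1), (16, 1), (17, 1)], [(16, 2), (17, 0)]] :
    List (List (Fin 18 × Fin 4)))

theorem isLinkDiagram_JS14 : JS14.IsLinkDiagram ∧ JS14.components = 2 :=
  Diagram.isLinkDiagram_of_isNumbered (m := 20) (by decide +kernel) rfl
    (faces := facesJS14) (by decide +kernel) rfl (by decide +kernel) (by decide +kernel)

theorem isLinkDiagram_T15 : T15.IsLinkDiagram ∧ T15.components = 2 :=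
  Diagram.isLinkDiagram_of_isNumbered (m := 20) (by decide +kernel) rfl
    (faces := facesT15) (by decide +kernel) rfl (by decide +kernel) (by decide +kernel)

theorem isLinkDiagram_unlink2 : unlink2.IsLinkDiagram ∧ unlink2.components = 2 := by
  have h0 : IsEmpty unlink2.End := inferInstanceAs (IsEmpty (Fin 0 × Fin 4))
  have h1 : IsEmpty (Fin unlink2.crossings.length) := inferInstanceAs (IsEmpty (Fin 0))
  have hq : ∀ r : unlink2.End → unlink2.End → Prop, Nat.card (Quot r) = 0 := fun r =>
    Nat.card_eq_zero.mpr (Or.inl ⟨Quot.ind h0.elim⟩)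
  have hq' : ∀ r : Fin unlink2.crossings.length → Fin unlink2.crossings.length → Prop,
      Nat.card (Quot r) = 0 := fun r => Nat.card_eq_zero.mpr (Or.inl ⟨Quot.ind h1.elim⟩)
  refine ⟨⟨by decide, by decide, ?_, fun p => h0.elim p⟩, ?_⟩
  · rw [hq, hq']
    rfl
  · rw [Diagram.components, hq]
    rfl

end VSE

theorem mainTheorem3 :
    -- the three diagrams are shaded plane diagrams of links with two components
    (∀ D ∈ [VSE.JS14, VSE.T15, VSE.unlink2], D.IsLinkDiagram ∧ D.components = 2) ∧
    VSE.JS14.crossings.length = 20 ∧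
    -- they have the same bracket
    VSE.JS14.bracket = VSE.unlink2.bracket ∧
    VSE.JS14.bracket = VSE.T15.bracket ∧
    -- the specialization at level 2 distinguishes `JS_14` from the other two links
    VSE.eta 2 VSE.JS14 =
      X 7 * (16 * (X 5 ^ 2 - 1) * X 7 ^ 2 + (16 * X 5 ^ 2 - 15) * X 7 - 32 * (X 5 ^ 2 - 1)) ∧
    VSE.eta 2 VSE.unlink2 = X 7 ^ 2 ∧
    VSE.eta 2 VSE.T15 = X 7 ^ 2 ∧
    VSE.eta 2 VSE.JS14 ≠ X 7 ^ 2 ∧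
    -- the number of states that it uses
    (VSE.JS14.nonNullStates 2).ncard = 801 ∧
    -- the VSE-invariant determines the bracket, but not conversely
    (∀ D D' : VSE.Diagram, VSE.etaInf D = VSE.etaInf D' → D.bracket = D'.bracket) ∧
    VSE.etaInf VSE.JS14 ≠ VSE.etaInf VSE.unlink2 ∧
    VSE.etaInf VSE.JS14 ≠ VSE.etaInf VSE.T15 := by
  refine ⟨?_, rfl, VSE.bracket_JS14_eq_unlink2,
    VSE.bracket_JS14_eq_unlink2.trans VSE.bracket_T15_eq_unlink2.symm, VSE.eta_two_JS14,
    VSE.eta_two_unlink2, VSE.eta_two_T15, VSE.eta_two_JS14_ne, VSE.ncard_nonNullStates_JS14,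
    fun D D' h => VSE.bracket_eq_of_etaInf_eq h, fun h => ?_, fun h => ?_⟩
  · simp only [List.forall_mem_cons]
    exact ⟨VSE.isLinkDiagram_JS14, VSE.isLinkDiagram_T15, VSE.isLinkDiagram_unlink2,
      List.forall_mem_nil _⟩
  · exact VSE.eta_two_JS14_ne ((VSE.eta_eq_of_etaInf_eq 2 h).trans VSE.eta_two_unlink2)
  · exact VSE.eta_two_JS14_ne ((VSE.eta_eq_of_etaInf_eq 2 h).trans VSE.eta_two_T15)
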